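/- \textbf{Lemma (splitting-off Lemma).} Work over $\mathbb{C}$. For points $p_0,\dots,p_n\in\mathbb{P}^2$ let $\mathcal{L}(d,m_0,m_1,\dots,m_n)$ denote the linear system of all plane curves of degree $d$ having multiplicity at least $m_i$ at $p_i$ for all $i$; write $m^n$ for the $n$ multiplicities $m,\dots,m$ at $p_1,\dots,p_n$. An irreducible plane curve $C$, of degree $\delta$ and with multiplicity $\mu_i$ at $p_i$, is a \emph{$(-1)$-curve} if its strict transform $\tilde C$ on the blow-up of $\mathbb{P}^2$ at $p_0,\dots,p_n$ is smooth and rational with $\tilde C^2=\delta^2-\sum_{i=0}^n\mu_i^2=-1$; put $\mathcal{L}(d,m_0,\dots,m_n)\cdot C=d\delta-\sum_{i=0}^n m_i\mu_i$. Let $n,d\ge 0$ be integers and let $p_0,\dots,p_n$ be general, that is, in a suitable nonempty Zariski open subset (depending only on $n$ and $d$) of $(\mathbb{P}^2)^{n+1}$. Let $m_0,m\ge 0$ be integers such that $\mathcal{L}=\mathcal{L}(d,m_0,m^n)$ is non-empty, and let $C$ be a $(-1)$-curve with $\mathcal{L}\cdot C\le -2$, of degree $\delta$ and with multiplicities $\mu_0,\dots,\mu_n$.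 Then at least one of the following holds. \begin{enumerate} \item $\mu_1=\dots=\mu_n$. \item There are an index $i_0\in\{1,\dots,n\}$ and an integer $\nu\ge 1$ with $\mu_{i_0}=\nu-1$ and $\mu_i=\nu$ for all $i\in\{1,\dots,n\}\setminus\{i_0\}$, and $\mathcal{L}(n\delta,n\mu_0,(n\nu-1)^n)=\{C_{tot}\}$. \item There are an index $i_0\in\{1,\dots,n\}$ and an integer $\nu\ge 0$ with $\mu_{i_0}=\nu+1$ and $\mu_i=\nu$ for all $i\in\{1,\dots,n\}\setminus\{i_0\}$, and $\mathcal{L}(n\delta,n\mu_0,(n\nu+1)^n)=\{C_{tot}\}$. \end{enumerate} Here (as part of the assertion in cases 2 and 3) for every permutation $\sigma$ of $\{1,\dots,n\}$ the system $\mathcal{L}(\delta,\mu_0,\mu_{\sigma(1)},\dots,\mu_{\sigma(n)})$ consists of a single curve $C_\sigma$, and $C_{tot}=\sum_{\sigma\in A}C_\sigma$, where $A$ is a maximal set of permutations such that the curves $C_\sigma$ with $\sigma\in A$ are pairwise different. -/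

import Mathlib

open MvPolynomial

noncomputable section

namespace PlaneCurves

/-- The projective plane over `ℂ`. -/
abbrev Plane : Type := Projectivization ℂ (Fin 3 → ℂ)

/-- Equations of plane curves. A plane curve (not necessarily reduced or irreducible) is given by
a nonzero homogeneous polynomial; two equations give the same curve iff they are `Associated`
(differ by a nonzero constant), and the sum of curves is given by the product of equations. -/
abbrev Form : Type := MvPolynomial (Fin 3) ℂ

/-- `P` holds for `k` general points of the plane: it holds on a nonempty Zariski open subset of
`(ℙ²)ᵏ`. (A basis of the nonempty open sets is given by the images of the loci `Φ ≠ 0` in the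
space of `k`-tuples of nonzero coordinate vectors, `Φ` a nonzero polynomial.) -/
def ForGeneralPoints {k : ℕ} (P : (Fin k → Plane) → Prop) : Prop :=
  ∃ Φ : MvPolynomial (Fin k × Fin 3) ℂ, Φ ≠ 0 ∧
    ∀ (v : Fin k → Fin 3 → ℂ) (hv : ∀ i, v i ≠ 0),
      eval (fun ij => v ij.1 ij.2) Φ ≠ 0 → P (fun i => Projectivization.mk ℂ (v i) (hv i))

/-- The multiplicity at `q` of the curve `F = 0`: the lowest degree that occurs in the Taylor
expansion of `F` at a coordinate vector of `q` (for homogeneous `F ≠ 0` the choice of the vector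
does not matter). -/
def multAt (F : Form) (q : Plane) : ℕ :=
  sInf {k : ℕ | homogeneousComponent k (aeval (fun j => (X j + C (q.rep j) : Form)) F) ≠ 0}

/-- The divisor class `deg · H - ∑ i, mult i · E_i` on the blow-up of the plane in `n + 1` distinct
points, where `H` is the pull-back of a line and `E_i` the `i`-th exceptional curve.
These classes form the Picard group of the blow-up. -/
@[ext] structure DivisorClass (n : ℕ) where
  deg : ℤ
  mult : Fin (n + 1) → ℤ

namespace DivisorClass

variable {n : ℕ}

/-- The intersection number: `H² = 1`, `E_i² = -1`, and all other products of `H` and the `E_i`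
are zero. -/
def inter (D D' : DivisorClass n) : ℤ :=
  D.deg * D'.deg - ∑ i, D.mult i * D'.mult i

/-- The quasi-homogeneous class `(d, m₀, mⁿ)`. -/
def quasiHom (n : ℕ) (d m₀ m : ℤ) : DivisorClass n :=
  ⟨d, Fin.cons m₀ (fun _ => m)⟩

/-- Permute the multiplicities at the last `n` points:
`(δ, μ₀, μ₁, …, μₙ)` becomes `(δ, μ₀, μ_{σ(1)}, …, μ_{σ(n)})`. -/
def permute (σ : Equiv.Perm (Fin n)) (D : DivisorClass n) : DivisorClass n :=
  ⟨D.deg, Fin.cons (D.mult 0) (fun i => D.mult (σ i).succ)⟩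

end DivisorClass

variable {n : ℕ}

/-- The linear system `L(d, m₀, …, mₙ)` of all curves of degree `d` with multiplicity at least
`m_i` at `p_i`, where `D = (d, m₀, …, mₙ)`. -/
def linearSystem (p : Fin (n + 1) → Plane) (D : DivisorClass n) : Set Form :=
  {F | F ≠ 0 ∧ F.IsHomogeneous F.totalDegree ∧ (F.totalDegree : ℤ) = D.deg ∧
    ∀ i, D.mult i ≤ (multAt F (p i) : ℤ)}

/-- The linear system of `D` consists of the single curve `F = 0`. -/
def IsSoleMember (p : Fin (n + 1) → Plane) (D : DivisorClass n) (F : Form) : Prop :=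
  F ∈ linearSystem p D ∧ ∀ G ∈ linearSystem p D, Associated G F

/-- The class of the strict transform of the curve `F = 0` on the blow-up. -/
def strictClass (p : Fin (n + 1) → Plane) (F : Form) : DivisorClass n :=
  ⟨F.totalDegree, fun i => multAt F (p i)⟩

/-- The polynomial `F (v + x w₁ + x t w₂)` in `x = X 0` and `t = X 1`: the equation `F` pulled back
to a chart of the blow-up of the plane at `[v]`, where `v, w₁, w₂` is a basis of `ℂ³`. The
exceptional curve is `x = 0` in this chart, and the charts for all `w₁, w₂` cover it. -/
def blowupChart (F : Form) (v w₁ w₂ : Fin 3 → ℂ) : MvPolynomial (Fin 2) ℂ :=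
  aeval (fun j => (C (v j) + X 0 * (C (w₁ j) + X 1 * C (w₂ j)) : MvPolynomial (Fin 2) ℂ)) F

/-- The strict transform of `F = 0` on the blow-up of the plane at the (distinct) points `p i` is
smooth (Jacobian criterion): first at the points away from the exceptional curves, then at the
points on the exceptional curves, where `G` is the local equation of the strict transform. -/
def StrictTransformSmooth (p : Fin (n + 1) → Plane) (F : Form) : Prop :=
  (∀ q : Plane, (∀ i, q ≠ p i) → eval q.rep F = 0 → ∃ j, eval q.rep (pderiv j F) ≠ 0) ∧
  ∀ i, ∀ w₁ w₂ : Fin 3 → ℂ, LinearIndependent ℂ ![(p i).rep, w₁, w₂] →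
    ∃ G : MvPolynomial (Fin 2) ℂ,
      blowupChart F (p i).rep w₁ w₂ = X 0 ^ multAt F (p i) * G ∧
      ∀ t : ℂ, eval ![0, t] G = 0 → ∃ j, eval ![0, t] (pderiv j G) ≠ 0

/-- The irreducible curve `F = 0` is rational: there is a birational map from `ℙ¹` to it, that is,
a point `[φ₀ : φ₁ : φ₂]` of the curve over the field `ℂ(t)` such that the ratios `φ_i / φ_j` (the
pull-backs of the generators `x_i / x_j` of the function field of the curve) generate `ℂ(t)`.
As the strict transform is birational to the curve, it is rational iff the curve is. -/
def IsRationalCurve (F : Form) : Prop :=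
  ∃ φ : Fin 3 → RatFunc ℂ, φ ≠ 0 ∧ aeval φ F = 0 ∧
    IntermediateField.adjoin ℂ {y : RatFunc ℂ | ∃ i j, y = φ i / φ j} = ⊤

/-- `F = 0` is a `(-1)`-curve: an irreducible plane curve whose strict transform on the blow-up at
the points `p i` is rational and smooth and has self-intersection number `-1`. -/
structure IsMinusOneCurve (p : Fin (n + 1) → Plane) (F : Form) : Prop where
  irreducible : Irreducible F
  homogeneous : F.IsHomogeneous F.totalDegree
  smooth : StrictTransformSmooth p F
  rational : IsRationalCurve F
  selfInter : (strictClass p F).inter (strictClass p F) = -1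

/-- `G = 0` is the curve `C_tot` associated with the curve `F = 0` of class `(δ, μ₀, μ₁, …, μₙ)`:
for each permutation `σ`, the curve `E σ` is the only member of
`L(δ, μ₀, μ_{σ(1)}, …, μ_{σ(n)})`; `A` is a maximal set of permutations such that the curves `E σ`,
`σ ∈ A`, are pairwise different; and `C_tot` is the sum of the curves `E σ` with `σ ∈ A`. -/
def IsTotalCurve (p : Fin (n + 1) → Plane) (F G : Form) : Prop :=
  ∃ (E : Equiv.Perm (Fin n) → Form) (A : Finset (Equiv.Perm (Fin n))),
    (∀ σ, IsSoleMember p ((strictClass p F).permute σ) (E σ)) ∧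
    Maximal (fun B : Finset (Equiv.Perm (Fin n)) =>
      (B : Set (Equiv.Perm (Fin n))).Pairwise fun σ τ => ¬ Associated (E σ) (E τ)) A ∧
    G = ∏ σ ∈ A, E σ

/-- `C_tot` is defined, and it is the only member of `L(D)`, that is `C_tot = L(D)`. -/
def TotalCurveIs (p : Fin (n + 1) → Plane) (F : Form) (D : DivisorClass n) : Prop :=
  (∃ G, IsTotalCurve p F G) ∧ ∀ G, IsTotalCurve p F G → IsSoleMember p D G

end PlaneCurves

end

open PlaneCurves DivisorClass

/-! Let `H` be a member of `L` and `C` the given curve `F`, with `L·C < 0`. By Bezout's inequality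
`C` is a component of `H`, so `δ ≤ d`. For general points, non-emptiness of a linear system of
degree at most `d` does not depend on the position of the points. Hence for each `σ` there is a
curve `C_σ` with the multiplicities at `p_1, …, p_n` permuted. Permuting back shows that `C_σ` is
again irreducible, has exactly these multiplicities, and has self-intersection `-1`
(`IsNegativeCurve.exists_permuted`).

As `L` is quasi-homogeneous, `L·C_σ = L·C < 0`. Two curves of self-intersection `-1` that both meet
`H` negatively satisfy `C·C_σ ≤ 0` (`IsNegativeCurve.inter_nonpos`), and so `∑ (μ_i - μ_{σ(i)})² = 2
(C·C_σ - C²) ≤ 2` for every `σ`. Testing this on transpositions and on products of two disjoint ones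
leaves only multiplicities that are constant, or constant but for one entry that differs by `ε =
±1`.

In the latter case there are `n` different `C_σ`, one for each position of the odd entry, and their
sum has class `(nδ, nμ_0, (nν+ε)^n)`. This class meets each `C_σ` in `-1`, so each `C_σ` splits off
from every member; comparing degrees, `C_tot` is the only member (`totalCurveIs_quasiHom`).

Bezout's inequality (`sum_mul_le_mul`) is proved by a dimension count for the map `(A, B) ↦ A F + B
G`. Independence of the position of the points (`forGeneralPoints_hasMember`) holds because
emptiness of a system is an open condition. -/

noncomputable section

namespace PlaneCurves

/-! ### Order of vanishing of a polynomial at the origin -/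

section VanishingOrder

variable {σ R : Type*} [CommRing R]

/-- The lowest degree that occurs in a polynomial. -/
def vanishingOrder (P : MvPolynomial σ R) : ℕ :=
  sInf {k : ℕ | homogeneousComponent k P ≠ 0}

theorem mem_pow_idealOfVars_iff_homogeneousComponent {P : MvPolynomial σ R} {k : ℕ} :
    P ∈ idealOfVars σ R ^ k ↔ ∀ j < k, homogeneousComponent j P = 0 := by
  rw [mem_pow_idealOfVars_iff']
  constructor
  · intro h j hj
    ext s
    rw [coeff_homogeneousComponent]
    split_ifs with hs
    · exact h s (by omega)
    · simp
  · intro h s hs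
    have := congrArg (coeff s) (h _ hs)
    simpa [coeff_homogeneousComponent] using this

theorem exists_homogeneousComponent_ne_zero {P : MvPolynomial σ R} (hP : P ≠ 0) :
    ∃ k ≤ P.totalDegree, homogeneousComponent k P ≠ 0 := by
  by_contra! h
  apply hP
  rw [← sum_homogeneousComponent P]
  exact Finset.sum_eq_zero fun i hi => h i (by simpa [Nat.lt_succ_iff] using hi)

/-- Ideal membership, unlike the infimum, passes directly through products, sums and substitutions.
The zero polynomial is excluded because its infimum, over the empty set, is `0`. -/
theorem le_vanishingOrder_iff {P : MvPolynomial σ R} (hP : P ≠ 0) {k : ℕ} :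
    k ≤ vanishingOrder P ↔ P ∈ idealOfVars σ R ^ k := by
  obtain ⟨l, -, hl⟩ := exists_homogeneousComponent_ne_zero hP
  rw [mem_pow_idealOfVars_iff_homogeneousComponent]
  constructor
  · intro h j hj
    by_contra hne
    have := Nat.sInf_le (s := {k : ℕ | homogeneousComponent k P ≠ 0}) hne
    unfold vanishingOrder at h
    omega
  · intro h
    refine le_csInf ⟨l, hl⟩ fun b hb => ?_
    by_contra! hlt
    exact hb (h b hlt)

theorem vanishingOrder_le_totalDegree {P : MvPolynomial σ R} (hP : P ≠ 0) :
    vanishingOrder P ≤ P.totalDegree := by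
  obtain ⟨l, hl, hne⟩ := exists_homogeneousComponent_ne_zero hP
  exact (Nat.sInf_le hne).trans hl

theorem homogeneousComponent_vanishingOrder_ne_zero {P : MvPolynomial σ R} (hP : P ≠ 0) :
    homogeneousComponent (vanishingOrder P) P ≠ 0 := by
  obtain ⟨l, -, hl⟩ := exists_homogeneousComponent_ne_zero hP
  exact Nat.sInf_mem (s := {k : ℕ | homogeneousComponent k P ≠ 0}) ⟨l, hl⟩

theorem sub_homogeneousComponent_mem {P : MvPolynomial σ R} {k : ℕ}
    (h : P ∈ idealOfVars σ R ^ k) :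
    P - homogeneousComponent k P ∈ idealOfVars σ R ^ (k + 1) := by
  rw [mem_pow_idealOfVars_iff'] at h ⊢
  intro s hs
  rw [coeff_sub, coeff_homogeneousComponent]
  split_ifs with hd
  · simp
  · rw [h s (by omega), sub_zero]

theorem _root_.MvPolynomial.IsHomogeneous.mem_pow_idealOfVars {P : MvPolynomial σ R} {k : ℕ}
    (h : P.IsHomogeneous k) : P ∈ idealOfVars σ R ^ k := by
  rw [mem_pow_idealOfVars_iff']
  exact fun s hs => h.coeff_eq_zero (by omega)

theorem _root_.MvPolynomial.IsHomogeneous.eq_zero_of_mem_pow {P : MvPolynomial σ R} {k : ℕ}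
    (h : P.IsHomogeneous k) (hP : P ∈ idealOfVars σ R ^ (k + 1)) : P = 0 := by
  rw [mem_pow_idealOfVars_iff'] at hP
  ext s
  by_cases hs : s.degree = k
  · exact hP s (by omega)
  · exact h.coeff_eq_zero hs

theorem vanishingOrder_mul [IsDomain R] {P Q : MvPolynomial σ R} (hP : P ≠ 0) (hQ : Q ≠ 0) :
    vanishingOrder (P * Q) = vanishingOrder P + vanishingOrder Q := by
  have hPQ := mul_ne_zero hP hQ
  have hPm := (le_vanishingOrder_iff hP).1 le_rfl
  have hQm := (le_vanishingOrder_iff hQ).1 le_rfl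
  set k := vanishingOrder P with hk
  set l := vanishingOrder Q with hl
  apply le_antisymm
  · by_contra! hlt
    have hmem := (le_vanishingOrder_iff hPQ).1 hlt
    have h0 : homogeneousComponent k P * homogeneousComponent l Q ≠ 0 :=
      mul_ne_zero (homogeneousComponent_vanishingOrder_ne_zero hP)
        (homogeneousComponent_vanishingOrder_ne_zero hQ)
    apply h0
    have hhom := (homogeneousComponent_isHomogeneous k P).mul
      (homogeneousComponent_isHomogeneous l Q)
    apply hhom.eq_zero_of_mem_pow
    -- Modulo order `k + l + 1`, the product `P * Q` is the product of the two lowest components.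
    have h1 : (P - homogeneousComponent k P) * Q ∈ idealOfVars σ R ^ (k + l + 1) := by
      have := Ideal.mul_mem_mul (sub_homogeneousComponent_mem hPm) hQm
      rwa [← pow_add, show k + 1 + l = k + l + 1 by ring] at this
    have h2 : homogeneousComponent k P * (Q - homogeneousComponent l Q) ∈
        idealOfVars σ R ^ (k + l + 1) := by
      have := Ideal.mul_mem_mul (homogeneousComponent_isHomogeneous k P).mem_pow_idealOfVars
        (sub_homogeneousComponent_mem hQm)
      rwa [← pow_add, show k + (l + 1) = k + l + 1 by ring] at this
    have := Ideal.sub_mem _ (Ideal.sub_mem _ hmem h1) h2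
    convert this using 1
    ring
  · rw [le_vanishingOrder_iff hPQ, pow_add]
    exact Ideal.mul_mem_mul hPm hQm

theorem isHomogeneous_of_totalDegree_le_vanishingOrder {P : MvPolynomial σ R} (hP : P ≠ 0)
    (h : P.totalDegree ≤ vanishingOrder P) : P.IsHomogeneous P.totalDegree := by
  have hm := (le_vanishingOrder_iff hP).1 h
  rw [mem_pow_idealOfVars_iff'] at hm
  rw [← mem_homogeneousSubmodule]
  intro s hs
  have h1 : s.degree ≤ P.totalDegree := by
    exact le_totalDegree (mem_support_iff.2 hs)
  have h2 : ¬ s.degree < P.totalDegree := fun h' => hs (hm s h')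
  have h3 : s.degree = P.totalDegree := by omega
  rw [← h3, Finsupp.degree_eq_weight_one]
  rfl

/-- Both the lowest and the highest degree are additive on products. They agree for the product, and
lowest is at most highest for each factor, so they agree for each factor. -/
theorem _root_.MvPolynomial.IsHomogeneous.of_mul [IsDomain R] {P Q : MvPolynomial σ R} {k : ℕ}
    (h : (P * Q).IsHomogeneous k) (hP : P ≠ 0) (hQ : Q ≠ 0) :
    P.IsHomogeneous P.totalDegree ∧ Q.IsHomogeneous Q.totalDegree := by
  have hPQ := mul_ne_zero hP hQ
  have h1 : k ≤ vanishingOrder P + vanishingOrder Q := by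
    rw [← vanishingOrder_mul hP hQ, le_vanishingOrder_iff hPQ]
    exact h.mem_pow_idealOfVars
  have h2 : P.totalDegree + Q.totalDegree = k := by
    rw [← totalDegree_mul_of_isDomain hP hQ]
    exact h.totalDegree hPQ
  have h3 := vanishingOrder_le_totalDegree hP
  have h4 := vanishingOrder_le_totalDegree hQ
  exact ⟨isHomogeneous_of_totalDegree_le_vanishingOrder hP (by omega),
    isHomogeneous_of_totalDegree_le_vanishingOrder hQ (by omega)⟩

end VanishingOrder

/-! ### Multiplicity of a form at a point of the plane -/

/-- The Taylor expansion of a form at `v`. -/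
def taylorShift (v : Fin 3 → ℂ) : Form →ₐ[ℂ] Form := aeval fun j => X j + C (v j)

theorem multAt_eq (F : Form) (q : Plane) : multAt F q = vanishingOrder (taylorShift q.rep F) := rfl

theorem taylorShift_neg_taylorShift (v : Fin 3 → ℂ) (F : Form) :
    taylorShift (-v) (taylorShift v F) = F := by
  have : (taylorShift (-v)).comp (taylorShift v) = AlgHom.id ℂ Form := by
    apply MvPolynomial.algHom_ext
    intro j
    simp [taylorShift]
  exact DFunLike.congr_fun this F

theorem taylorShift_ne_zero (v : Fin 3 → ℂ) {F : Form} (hF : F ≠ 0) : taylorShift v F ≠ 0 := by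
  intro h
  apply hF
  rw [← taylorShift_neg_taylorShift v F, h, map_zero]

theorem le_multAt_iff {F : Form} (hF : F ≠ 0) {q : Plane} {m : ℕ} :
    m ≤ multAt F q ↔ taylorShift q.rep F ∈ idealOfVars (Fin 3) ℂ ^ m := by
  rw [multAt_eq, le_vanishingOrder_iff (taylorShift_ne_zero _ hF)]

theorem multAt_mul {F G : Form} (hF : F ≠ 0) (hG : G ≠ 0) (q : Plane) :
    multAt (F * G) q = multAt F q + multAt G q := by
  simp only [multAt_eq, map_mul]
  exact vanishingOrder_mul (taylorShift_ne_zero _ hF) (taylorShift_ne_zero _ hG)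

theorem totalDegree_aeval_le {σ τ R : Type*} [CommRing R] (g : σ → MvPolynomial τ R)
    (hg : ∀ i, (g i).totalDegree ≤ 1) (F : MvPolynomial σ R) :
    (aeval g F).totalDegree ≤ F.totalDegree := by
  rw [aeval_def, eval₂_eq]
  refine (totalDegree_finsetSum _ _).trans (Finset.sup_le fun s hs => ?_)
  refine (totalDegree_mul _ _).trans ?_
  rw [MvPolynomial.algebraMap_eq, totalDegree_C, zero_add]
  refine (totalDegree_finsetProd _ _).trans (le_trans (Finset.sum_le_sum fun i _ => ?_)
    (le_totalDegree hs))
  exact (totalDegree_pow _ _).trans (by simpa using Nat.mul_le_mul_left (s i) (hg i))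

theorem multAt_le_totalDegree {F : Form} (hF : F ≠ 0) (q : Plane) :
    multAt F q ≤ F.totalDegree := by
  rw [multAt_eq]
  refine (vanishingOrder_le_totalDegree (taylorShift_ne_zero _ hF)).trans
    (totalDegree_aeval_le _ (fun i => ?_) F)
  refine (totalDegree_add _ _).trans ?_
  simp

theorem multAt_isUnit {F : Form} (hF : IsUnit F) (q : Plane) : multAt F q = 0 := by
  have h := multAt_le_totalDegree hF.ne_zero q
  rw [(isUnit_iff_totalDegree_of_isReduced.1 hF).2] at h
  omega

theorem totalDegree_isUnit {F : Form} (hF : IsUnit F) : F.totalDegree = 0 :=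
  (isUnit_iff_totalDegree_of_isReduced.1 hF).2

theorem isUnit_of_totalDegree_eq_zero {F : Form} (h0 : F ≠ 0) (h : F.totalDegree = 0) :
    IsUnit F := by
  rw [totalDegree_eq_zero_iff_eq_C] at h
  rw [h] at h0 ⊢
  exact (IsUnit.mk0 _ (fun h' => h0 (by rw [h', C_0]))).map C

theorem multAt_associated {F G : Form} (h : Associated F G) (q : Plane) :
    multAt F q = multAt G q := by
  obtain ⟨u, rfl⟩ := h
  by_cases hF : F = 0
  · simp [hF]
  · rw [multAt_mul hF u.ne_zero, multAt_isUnit u.isUnit, add_zero]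

theorem totalDegree_associated {F G : Form} (h : Associated F G) :
    F.totalDegree = G.totalDegree := by
  obtain ⟨u, rfl⟩ := h
  by_cases hF : F = 0
  · simp [hF]
  · rw [totalDegree_mul_of_isDomain hF u.ne_zero, totalDegree_isUnit u.isUnit, add_zero]

theorem _root_.MvPolynomial.IsHomogeneous.aeval_mul {σ R S : Type*} [CommRing R] [CommRing S]
    [Algebra R S] {F : MvPolynomial σ R} {d : ℕ} (hF : F.IsHomogeneous d) (c : S) (g : σ → S) :
    aeval (fun j => c * g j) F = c ^ d * aeval g F := by
  simp only [aeval_def, eval₂_eq, Finset.mul_sum]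
  refine Finset.sum_congr rfl fun s hs => ?_
  have : ∑ i ∈ s.support, s i = d := (hF.degree_eq_sum_deg_support hs).symm
  simp only [mul_pow, Finset.prod_mul_distrib, Finset.prod_pow_eq_pow_sum, this]
  ring

/-- The substitution that multiplies all variables by `a`. -/
def scaleVars (a : ℂ) : Form →ₐ[ℂ] Form := aeval fun j => C a * X j

theorem scaleVars_mem {a : ℂ} {F : Form} {m : ℕ} (h : F ∈ idealOfVars (Fin 3) ℂ ^ m) :
    scaleVars a F ∈ idealOfVars (Fin 3) ℂ ^ m := by
  have hρ : idealOfVars (Fin 3) ℂ ≤ (idealOfVars (Fin 3) ℂ).comap (scaleVars a) := by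
    rw [idealOfVars, Ideal.span_le]
    rintro _ ⟨j, rfl⟩
    rw [SetLike.mem_coe, Ideal.mem_comap, scaleVars, aeval_X]
    exact Ideal.mul_mem_left _ _ (Ideal.subset_span ⟨j, rfl⟩)
  exact Ideal.mem_comap.1 (Ideal.le_comap_pow (scaleVars a) m (Ideal.pow_right_mono hρ m h))

theorem scaleVars_comp_taylorShift (a : ℂ) (v : Fin 3 → ℂ) :
    (scaleVars a).comp (taylorShift (a • v)) = aeval fun j => C a * (X j + C (v j)) := by
  apply MvPolynomial.algHom_ext
  intro j
  simp [scaleVars, mul_add, taylorShift]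

theorem taylorShift_smul_mem {F : Form} {d m : ℕ} (hF : F.IsHomogeneous d) {v : Fin 3 → ℂ} {a : ℂ}
    (ha : a ≠ 0) (h : taylorShift (a • v) F ∈ idealOfVars (Fin 3) ℂ ^ m) :
    taylorShift v F ∈ idealOfVars (Fin 3) ℂ ^ m := by
  have h1 := scaleVars_mem (a := a) h
  rw [← AlgHom.comp_apply, scaleVars_comp_taylorShift, hF.aeval_mul, ← C_pow] at h1
  have h4 := Ideal.mul_mem_left _ (C (a ^ d)⁻¹) h1
  rwa [← mul_assoc, ← C_mul, inv_mul_cancel₀ (pow_ne_zero _ ha), C_1, one_mul] at h4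

/-- Multiplicity is defined by a chosen representative. For a homogeneous form, rescaling the vector
only rescales the variables and multiplies the expansion by a constant, so any coordinate vector may
be used. -/
theorem le_multAt_mk_iff {F : Form} (hF : F ≠ 0) {d : ℕ} (hd : F.IsHomogeneous d)
    {v : Fin 3 → ℂ} (hv : v ≠ 0) {m : ℕ} :
    m ≤ multAt F (Projectivization.mk ℂ v hv) ↔
      taylorShift v F ∈ idealOfVars (Fin 3) ℂ ^ m := by
  rw [le_multAt_iff hF]
  obtain ⟨a, ha⟩ := Projectivization.exists_smul_eq_mk_rep ℂ v hv
  rw [← ha]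
  constructor
  · exact taylorShift_smul_mem hd a.ne_zero
  · intro h
    apply taylorShift_smul_mem hd (a := (a⁻¹ : ℂˣ)) (Units.ne_zero _)
    rw [Units.smul_def, smul_smul]
    simpa using h

/-! ### Dimensions of spaces of jets and forms -/

section Dimension

/-- The exponents of the monomials of degree less than `k` in two variables. -/
def jetIndex (k : ℕ) : Finset (Fin 2 →₀ ℕ) :=
  (Finset.range k).biUnion fun j => Finset.univ.finsuppAntidiag j

theorem mem_finsuppAntidiag_univ {σ : Type*} [Fintype σ] [DecidableEq σ] {s : σ →₀ ℕ} {k : ℕ} :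
    s ∈ Finset.univ.finsuppAntidiag k ↔ s.degree = k := by
  simp [Finset.mem_finsuppAntidiag, Finsupp.degree_eq_sum]

theorem mem_jetIndex {k : ℕ} {s : Fin 2 →₀ ℕ} : s ∈ jetIndex k ↔ s.degree < k := by
  simp only [jetIndex, Finset.mem_biUnion, Finset.mem_range, mem_finsuppAntidiag_univ]
  exact ⟨fun ⟨j, hj, h⟩ => h ▸ hj, fun h => ⟨_, h, rfl⟩⟩

theorem card_jetIndex (k : ℕ) : (jetIndex k).card = (k + 1).choose 2 := by
  rw [jetIndex, Finset.card_biUnion]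
  · induction k with
    | zero => rfl
    | succ k ih =>
      rw [Finset.sum_range_succ, ih, Finset.card_finsuppAntidiag_nat_eq_choose, Finset.card_univ,
        Fintype.card_fin, show 2 + k - 1 = k + 1 by omega, Nat.choose_succ_self_right,
        Nat.choose_succ_succ' (k + 1) 1, Nat.choose_one_right]
      ring
  · intro i _ j _ hij
    refine Finset.disjoint_left.2 fun s hs hs' => ?_
    rw [mem_finsuppAntidiag_univ] at hs hs'
    exact hij (hs.symm.trans hs')

/-- The coefficients of a homogeneous polynomial of degree `N`. -/
def coeffMap (N : ℕ) : homogeneousSubmodule (Fin 3) ℂ N →ₗ[ℂ]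
    ((Finset.univ : Finset (Fin 3)).finsuppAntidiag N → ℂ) :=
  LinearMap.pi fun s => (lcoeff ℂ (s : Fin 3 →₀ ℕ)).comp (Submodule.subtype _)

theorem coeffMap_apply (N : ℕ) (F : homogeneousSubmodule (Fin 3) ℂ N)
    (s : (Finset.univ : Finset (Fin 3)).finsuppAntidiag N) :
    coeffMap N F s = coeff (s : Fin 3 →₀ ℕ) (F : Form) := rfl

theorem coeffMap_bijective (N : ℕ) : Function.Bijective (coeffMap N) := by
  constructor
  · rw [injective_iff_map_eq_zero]
    rintro ⟨F, hF⟩ h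
    ext s
    by_cases hs : s.degree = N
    · exact congrFun h ⟨s, mem_finsuppAntidiag_univ.2 hs⟩
    · exact hF.coeff_eq_zero hs
  · intro c
    refine ⟨⟨∑ s : (Finset.univ : Finset (Fin 3)).finsuppAntidiag N,
      monomial (s : Fin 3 →₀ ℕ) (c s), ?_⟩, ?_⟩
    · exact IsHomogeneous.sum _ _ _ fun s _ =>
        isHomogeneous_monomial _ (mem_finsuppAntidiag_univ.1 s.2)
    · ext t
      rw [coeffMap_apply, coeff_sum, Finset.sum_eq_single t]
      · simp
      · intro s _ hs
        rw [coeff_monomial, if_neg fun h => hs (Subtype.ext h)]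
      · simp

instance (N : ℕ) : FiniteDimensional ℂ (homogeneousSubmodule (Fin 3) ℂ N) :=
  Module.Finite.equiv (LinearEquiv.ofBijective _ (coeffMap_bijective N)).symm

theorem finrank_homogeneousSubmodule (N : ℕ) :
    Module.finrank ℂ (homogeneousSubmodule (Fin 3) ℂ N) = (N + 2).choose 2 := by
  rw [(LinearEquiv.ofBijective _ (coeffMap_bijective N)).finrank_eq, Module.finrank_fintype_fun_eq_card,
    Fintype.card_coe, Finset.card_finsuppAntidiag_nat_eq_choose, Finset.card_univ,
    Fintype.card_fin, show 3 + N - 1 = N + 2 by omega, Nat.choose_symm_add]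

theorem finrank_ker_comp_le {K V W U : Type*} [Field K] [AddCommGroup V] [Module K V]
    [AddCommGroup W] [Module K W] [AddCommGroup U] [Module K U] [FiniteDimensional K V]
    [FiniteDimensional K W] (f : V →ₗ[K] W) (g : W →ₗ[K] U) :
    Module.finrank K (g.comp f).ker ≤ Module.finrank K f.ker + Module.finrank K g.ker := by
  let f' := f.domRestrict (g.comp f).ker
  have h1 := f'.finrank_range_add_finrank_ker
  have h2 : Module.finrank K f'.range ≤ Module.finrank K g.ker := by
    apply Submodule.finrank_mono
    rintro _ ⟨⟨x, hx⟩, rfl⟩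
    exact hx
  have h3 : Module.finrank K f'.ker ≤ Module.finrank K f.ker := by
    let φ : f'.ker →ₗ[K] f.ker :=
      LinearMap.codRestrict _ ((Submodule.subtype _).comp (Submodule.subtype _)) fun x => x.2
    apply LinearMap.finrank_le_finrank_of_injective (f := φ)
    intro x y hxy
    exact Subtype.ext (Subtype.ext (congrArg (fun z : f.ker => (z : V)) hxy))
  omega

theorem finrank_le_finrank_ker_add {K V W : Type*} [Field K] [AddCommGroup V] [Module K V]
    [AddCommGroup W] [Module K W] [FiniteDimensional K V] [FiniteDimensional K W]
    (f : V →ₗ[K] W) : Module.finrank K V ≤ Module.finrank K f.ker + Module.finrank K W := by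
  have h1 := f.finrank_range_add_finrank_ker
  have h2 := f.range.finrank_le
  omega

end Dimension

/-! ### Expansions in affine coordinates -/

section LocalExpansion

/-- The expansion of a form at `v` in the local coordinates `X 0`, `X 1` on the affine plane
through `v` on which the first homogeneous coordinate is constant. -/
def localExpansion (v : Fin 3 → ℂ) : Form →ₐ[ℂ] MvPolynomial (Fin 2) ℂ :=
  aeval ![C (v 0), C (v 1) + X 0, C (v 2) + X 1]

theorem localExpansion_eq (v : Fin 3 → ℂ) :
    localExpansion v = (aeval ![0, X 0, X 1]).comp (taylorShift v) := by
  apply MvPolynomial.algHom_ext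
  intro j
  fin_cases j <;> simp [localExpansion, taylorShift, add_comm]

/-- Jets are taken in two affine variables, where vanishing to order `k` costs exactly `(k +
1).choose 2` conditions; this is the number that the dimension count needs. -/
theorem localExpansion_mem {v : Fin 3 → ℂ} {F : Form} {m : ℕ}
    (h : taylorShift v F ∈ idealOfVars (Fin 3) ℂ ^ m) :
    localExpansion v F ∈ idealOfVars (Fin 2) ℂ ^ m := by
  rw [localExpansion_eq, AlgHom.comp_apply]
  have hρ : idealOfVars (Fin 3) ℂ ≤ (idealOfVars (Fin 2) ℂ).comap
      (aeval (R := ℂ) ![(0 : MvPolynomial (Fin 2) ℂ), X 0, X 1]) := by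
    rw [idealOfVars, Ideal.span_le]
    rintro _ ⟨j, rfl⟩
    rw [SetLike.mem_coe, Ideal.mem_comap, aeval_X]
    fin_cases j
    · exact Ideal.zero_mem _
    · exact Ideal.subset_span ⟨0, rfl⟩
    · exact Ideal.subset_span ⟨1, rfl⟩
  exact Ideal.mem_comap.1 (Ideal.le_comap_pow _ m (Ideal.pow_right_mono hρ m h))

/-- A polynomial with nonzero constant term has order zero, and orders add up. -/
theorem mem_of_mul_mem_of_coeff_zero_ne_zero {σ R : Type*} [CommRing R] [IsDomain R]
    {Q h : MvPolynomial σ R} {k : ℕ} (hQh : Q * h ∈ idealOfVars σ R ^ k) (h0 : coeff 0 h ≠ 0) :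
    Q ∈ idealOfVars σ R ^ k := by
  by_cases hQ : Q = 0
  · rw [hQ]
    exact Ideal.zero_mem _
  have hh : h ≠ 0 := by
    rintro rfl
    exact h0 (coeff_zero _)
  have hv : vanishingOrder h = 0 := by
    apply Nat.eq_zero_of_le_zero
    apply Nat.sInf_le
    simpa [homogeneousComponent_zero] using h0
  rw [← le_vanishingOrder_iff (mul_ne_zero hQ hh), vanishingOrder_mul hQ hh, hv] at hQh
  exact (le_vanishingOrder_iff hQ).1 hQh

variable {ι : Type*} (v : ι → Fin 3 → ℂ)

/-- The jets of orders `k i` of a form at the points `v i`. -/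
def jets (k : ι → ℕ) : Form →ₗ[ℂ] (Σ i, jetIndex (k i)) → ℂ :=
  LinearMap.pi fun x => (lcoeff ℂ (x.2 : Fin 2 →₀ ℕ)).comp (localExpansion (v x.1)).toLinearMap

variable {v} in
theorem jets_eq_zero_iff {k : ι → ℕ} {F : Form} :
    jets v k F = 0 ↔ ∀ i, localExpansion (v i) F ∈ idealOfVars (Fin 2) ℂ ^ k i := by
  simp only [mem_pow_idealOfVars_iff']
  constructor
  · intro h i s hs
    exact congrFun h ⟨i, s, mem_jetIndex.2 hs⟩
  · intro h
    funext ⟨i, s, hs⟩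
    exact h i s (mem_jetIndex.1 hs)

theorem finrank_jets [Fintype ι] (k : ι → ℕ) :
    Module.finrank ℂ ((Σ i, jetIndex (k i)) → ℂ) = ∑ i, (k i + 1).choose 2 := by
  rw [Module.finrank_fintype_fun_eq_card, Fintype.card_sigma]
  simp [card_jetIndex]

end LocalExpansion

/-! ### Forms with prescribed jets -/

section Interpolation

variable {ι : Type*} [Fintype ι] [DecidableEq ι] (v : ι → Fin 3 → ℂ) (k : ι → ℕ)

/-- A form that vanishes to order `k j` at all points `v j` with `j ≠ i`, but not at `v i`. -/
def separator (i : ι) : Form :=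
  ∏ j ∈ Finset.univ.erase i, (C (v j 0) * X 1 - C (v j 1) * X 0) ^ k j

theorem separator_isHomogeneous (i : ι) :
    (separator v k i).IsHomogeneous (∑ j ∈ Finset.univ.erase i, k j) := by
  apply IsHomogeneous.prod
  intro j _
  simpa using ((isHomogeneous_C_mul_X (v j 0) 1).sub (isHomogeneous_C_mul_X (v j 1) 0)).pow (k j)

theorem localExpansion_separator_mem {i j : ι} (hij : j ≠ i) :
    localExpansion (v j) (separator v k i) ∈ idealOfVars (Fin 2) ℂ ^ k j := by
  rw [separator, ← Finset.mul_prod_erase _ _ (Finset.mem_erase.2 ⟨hij, Finset.mem_univ j⟩),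
    map_mul, map_pow]
  apply Ideal.mul_mem_right
  apply Ideal.pow_mem_pow
  have : localExpansion (v j) (C (v j 0) * X 1 - C (v j 1) * X 0) = C (v j 0) * X 0 := by
    simp [localExpansion]
    ring
  rw [this]
  exact Ideal.mul_mem_left _ _ (Ideal.subset_span ⟨0, rfl⟩)

theorem coeff_zero_localExpansion_separator_ne_zero
    (h1 : ∀ i j, i ≠ j → v i 1 * v j 0 ≠ v j 1 * v i 0) (i : ι) :
    coeff 0 (localExpansion (v i) (separator v k i)) ≠ 0 := by
  rw [← constantCoeff_eq, separator, map_prod, map_prod]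
  refine Finset.prod_ne_zero_iff.2 fun j hj => ?_
  rw [map_pow, map_pow]
  apply pow_ne_zero
  have := h1 i j (Finset.ne_of_mem_erase hj).symm
  simpa [localExpansion, sub_eq_zero, mul_comm] using this

/-- A form of degree `N` that vanishes to order `k j` at all points `v j` with `j ≠ i`, and whose
expansion at `v i` begins with the monomial of exponent `s`. -/
def interpolator (N : ℕ) (i : ι) (s : Fin 2 →₀ ℕ) : Form :=
  (X 1 - C (v i 1 / v i 0) * X 0) ^ s 0 * (X 2 - C (v i 2 / v i 0) * X 0) ^ s 1 *
    (C (v i 0)⁻¹ * X 0) ^ (N - s.degree - ∑ j ∈ Finset.univ.erase i, k j) * separator v k i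

theorem interpolator_isHomogeneous {N : ℕ} {i : ι} {s : Fin 2 →₀ ℕ} (hs : s.degree < k i)
    (hN : ∑ j, k j ≤ N) : (interpolator v k N i s).IsHomogeneous N := by
  have h1 : (X 1 - C (v i 1 / v i 0) * X 0 : Form).IsHomogeneous 1 :=
    (isHomogeneous_X _ _).sub (isHomogeneous_C_mul_X _ _)
  have h2 : (X 2 - C (v i 2 / v i 0) * X 0 : Form).IsHomogeneous 1 :=
    (isHomogeneous_X _ _).sub (isHomogeneous_C_mul_X _ _)
  have h3 : (C (v i 0)⁻¹ * X 0 : Form).IsHomogeneous 1 := isHomogeneous_C_mul_X _ _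
  have h := (((h1.pow (s 0)).mul (h2.pow (s 1))).mul
    (h3.pow (N - s.degree - ∑ j ∈ Finset.univ.erase i, k j))).mul (separator_isHomogeneous v k i)
  have hsum := Finset.add_sum_erase Finset.univ k (Finset.mem_univ i)
  have hdeg : s.degree = s 0 + s 1 := by simp [Finsupp.degree_eq_sum]
  -- No truncation occurs in the subtraction, since `s.degree < k i` and `∑ j, k j ≤ N`.
  have hdegree : 1 * s 0 + 1 * s 1 + 1 * (N - s.degree - ∑ j ∈ Finset.univ.erase i, k j) +
      ∑ j ∈ Finset.univ.erase i, k j = N := by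
    omega
  rwa [hdegree] at h

theorem localExpansion_interpolator (h0 : ∀ i, v i 0 ≠ 0) (N : ℕ) (i : ι) (s : Fin 2 →₀ ℕ) :
    localExpansion (v i) (interpolator v k N i s) =
      monomial s 1 * localExpansion (v i) (separator v k i) := by
  have hv := h0 i
  have e1 : localExpansion (v i) (X 1 - C (v i 1 / v i 0) * X 0) = X 0 := by
    simp only [localExpansion, map_sub, map_mul, aeval_X, algHom_C, algebraMap_eq,
      Matrix.cons_val_zero, Matrix.cons_val_one]
    rw [← C_mul, div_mul_cancel₀ _ hv]
    ring
  have e2 : localExpansion (v i) (X 2 - C (v i 2 / v i 0) * X 0) = X 1 := by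
    simp only [localExpansion, map_sub, map_mul, aeval_X, algHom_C, algebraMap_eq,
      Matrix.cons_val_zero, Matrix.cons_val]
    rw [← C_mul, div_mul_cancel₀ _ hv]
    ring
  have e3 : localExpansion (v i) (C (v i 0)⁻¹ * X 0) = 1 := by
    simp only [localExpansion, map_mul, aeval_X, algHom_C, algebraMap_eq, Matrix.cons_val_zero]
    rw [← C_mul, inv_mul_cancel₀ hv, C_1]
  rw [interpolator, map_mul, map_mul, map_mul, map_pow, map_pow, map_pow, e1, e2, e3, one_pow,
    mul_one, monomial_eq]
  simp [Finsupp.prod_fintype]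

/-- There are as many interpolators as jet coordinates, and their jets are linearly independent; an
injective endomorphism of a finite-dimensional space is surjective. -/
theorem jets_surjective (h0 : ∀ i, v i 0 ≠ 0)
    (h1 : ∀ i j, i ≠ j → v i 1 * v j 0 ≠ v j 1 * v i 0) {N : ℕ} (hN : ∑ j, k j ≤ N) :
    Function.Surjective ((jets v k).comp (homogeneousSubmodule (Fin 3) ℂ N).subtype) := by
  let A : (Σ i, jetIndex (k i)) → homogeneousSubmodule (Fin 3) ℂ N := fun x =>
    ⟨interpolator v k N x.1 x.2, interpolator_isHomogeneous v k (mem_jetIndex.1 x.2.2) hN⟩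
  let Λ := Fintype.linearCombination ℂ A
  have hinj : Function.Injective
      (((jets v k).comp (homogeneousSubmodule (Fin 3) ℂ N).subtype).comp Λ) := by
    rw [injective_iff_map_eq_zero]
    intro c hc
    have hc' : jets v k (Λ c : Form) = 0 := hc
    rw [jets_eq_zero_iff] at hc'
    have hΛ : (Λ c : Form) = ∑ i, ∑ s : jetIndex (k i), c ⟨i, s⟩ • interpolator v k N i s := by
      simp only [Λ, Fintype.linearCombination_apply, Submodule.coe_sum, Submodule.coe_smul, A]
      rw [← Finset.univ_sigma_univ, Finset.sum_sigma]
    -- At `v i` the interpolators of the other points vanish to order `k i`. Those of `v i` share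
    -- the separator as a factor, which is nonzero at `v i` and can be cancelled. What remains has
    -- degree less than `k i`, so it can lie in the `k i`-th power only if it is zero.
    have key : ∀ i, (∑ s : jetIndex (k i), monomial (s : Fin 2 →₀ ℕ) (c ⟨i, s⟩)) ∈
        idealOfVars (Fin 2) ℂ ^ k i := by
      intro i
      apply mem_of_mul_mem_of_coeff_zero_ne_zero _
        (coeff_zero_localExpansion_separator_ne_zero v k h1 i)
      have hi := hc' i
      rw [hΛ, map_sum, ← Finset.add_sum_erase _ _ (Finset.mem_univ i)] at hi
      have hrest : ∑ j ∈ Finset.univ.erase i, localExpansion (v i)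
          (∑ s : jetIndex (k j), c ⟨j, s⟩ • interpolator v k N j s) ∈
          idealOfVars (Fin 2) ℂ ^ k i := by
        refine Ideal.sum_mem _ fun j hj => ?_
        rw [map_sum]
        refine Ideal.sum_mem _ fun s _ => ?_
        rw [map_smul, smul_eq_C_mul, interpolator, map_mul]
        exact Ideal.mul_mem_left _ _ (Ideal.mul_mem_left _ _
          (localExpansion_separator_mem v k (Finset.ne_of_mem_erase hj).symm))
      have hfirst := (Ideal.add_mem_iff_left _ hrest).1 hi
      convert hfirst using 1
      rw [map_sum, Finset.sum_mul]
      refine Finset.sum_congr rfl fun s _ => ?_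
      rw [map_smul, localExpansion_interpolator v k h0, ← smul_mul_assoc, smul_monomial,
        smul_eq_mul, mul_one]
    funext ⟨i, s, hs⟩
    have hk := key i
    rw [mem_pow_idealOfVars_iff'] at hk
    have hcoeff := hk s (mem_jetIndex.1 hs)
    rw [coeff_sum, Finset.sum_eq_single ⟨s, hs⟩] at hcoeff
    · simpa using hcoeff
    · intro t _ ht
      rw [coeff_monomial, if_neg fun h => ht (Subtype.ext h)]
    · simp
  have hsurj := LinearMap.injective_iff_surjective.1 hinj
  rw [LinearMap.coe_comp] at hsurj
  exact hsurj.of_comp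

end Interpolation

/-! ### Bezout's inequality by a dimension count -/

section Bezout

variable {F G : Form} {δ e : ℕ}

/-- The map `(A, B) ↦ A F + B G` on forms of complementary degrees. -/
def combination (hF : F.IsHomogeneous δ) (hG : G.IsHomogeneous e) (M : ℕ) :
    homogeneousSubmodule (Fin 3) ℂ (M + e) × homogeneousSubmodule (Fin 3) ℂ (M + δ) →ₗ[ℂ]
      homogeneousSubmodule (Fin 3) ℂ (M + δ + e) :=
  LinearMap.codRestrict _
    (((LinearMap.mulRight ℂ F).comp (Submodule.subtype _)).coprod
      ((LinearMap.mulRight ℂ G).comp (Submodule.subtype _))) fun x => by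
    have h1 := IsHomogeneous.mul x.1.2 hF
    have h2 := IsHomogeneous.mul x.2.2 hG
    rw [show M + e + δ = M + δ + e by ring] at h1
    exact h1.add h2

/-- All syzygies are of Koszul type: `A F + B G = 0` with `F` prime and not dividing `G` gives `B =
F H`, hence `A = -H G`, and `H` is a form of degree `M`. -/
theorem finrank_ker_combination_le (hF : F.IsHomogeneous δ) (hG : G.IsHomogeneous e)
    (hFp : Prime F) (hFG : ¬ F ∣ G) (M : ℕ) :
    Module.finrank ℂ (combination hF hG M).ker ≤ (M + 2).choose 2 := by
  rw [← finrank_homogeneousSubmodule M]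
  let φ : homogeneousSubmodule (Fin 3) ℂ M →ₗ[ℂ] (homogeneousSubmodule (Fin 3) ℂ (M + e) ×
      homogeneousSubmodule (Fin 3) ℂ (M + δ)) :=
    LinearMap.prod
      (LinearMap.codRestrict _ ((-LinearMap.mulRight ℂ G).comp (Submodule.subtype _))
        fun x => (IsHomogeneous.mul x.2 hG).neg)
      (LinearMap.codRestrict _ ((LinearMap.mulRight ℂ F).comp (Submodule.subtype _))
        fun x => IsHomogeneous.mul x.2 hF)
  have hle : (combination hF hG M).ker ≤ φ.range := by
    rintro ⟨⟨A, hA⟩, ⟨B, hB⟩⟩ hx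
    have hx' : A * F + B * G = 0 := congrArg Subtype.val (LinearMap.mem_ker.1 hx)
    have hdvd : F ∣ B := by
      refine (hFp.dvd_or_dvd (a := B) (b := G) ⟨-A, ?_⟩).resolve_right hFG
      linear_combination hx'
    obtain ⟨H, rfl⟩ := hdvd
    have hAH : A = -(H * G) := by
      apply mul_right_cancel₀ hFp.ne_zero
      linear_combination hx'
    have hH : H.IsHomogeneous M := by
      by_cases h0 : H = 0
      · rw [h0]
        exact isHomogeneous_zero _ _ _
      have hB' : (F * H).IsHomogeneous (M + δ) := hB
      have h1 := (hB'.of_mul hFp.ne_zero h0).2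
      have h2 := hB'.totalDegree (mul_ne_zero hFp.ne_zero h0)
      rw [totalDegree_mul_of_isDomain hFp.ne_zero h0, hF.totalDegree hFp.ne_zero] at h2
      rwa [show H.totalDegree = M by omega] at h1
    refine ⟨⟨H, hH⟩, ?_⟩
    refine Prod.ext (Subtype.ext ?_) (Subtype.ext ?_)
    · exact hAH.symm
    · exact mul_comm H F
  exact (Submodule.finrank_mono hle).trans φ.finrank_range_le

theorem choose_two_cast (a : ℕ) : (((a + 1).choose 2 : ℕ) : ℚ) = (a + 1) * a / 2 := by
  rw [Nat.cast_choose_two]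
  push_cast
  ring

/-- Bezout's inequality with multiplicities. -/
theorem sum_mul_le_mul {ι : Type*} [Fintype ι] (v : ι → Fin 3 → ℂ) (h0 : ∀ i, v i 0 ≠ 0)
    (h1 : ∀ i j, i ≠ j → v i 1 * v j 0 ≠ v j 1 * v i 0) (hF : F.IsHomogeneous δ)
    (hG : G.IsHomogeneous e) (hFp : Prime F) (hFG : ¬ F ∣ G) (μ m : ι → ℕ)
    (hμ : ∀ i, localExpansion (v i) F ∈ idealOfVars (Fin 2) ℂ ^ μ i)
    (hm : ∀ i, localExpansion (v i) G ∈ idealOfVars (Fin 2) ℂ ^ m i) :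
    ∑ i, μ i * m i ≤ δ * e := by
  classical
  let k : ι → ℕ := fun i => μ i + m i
  -- Large enough for jets of orders `k i` to be imposed independently in degree `M + δ + e`.
  let M := ∑ i, k i
  let Ψ := (jets v k).comp (homogeneousSubmodule (Fin 3) ℂ (M + δ + e)).subtype
  let Θ := ((jets v m).comp (homogeneousSubmodule (Fin 3) ℂ (M + e)).subtype).prodMap
    ((jets v μ).comp (homogeneousSubmodule (Fin 3) ℂ (M + δ)).subtype)
  -- If `A` vanishes to the orders of `G` and `B` to those of `F`, then `A F + B G` vanishes to the
  -- sums of the orders.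
  have hker : Θ.ker ≤ (Ψ.comp (combination hF hG M)).ker := by
    rintro ⟨A, B⟩ hx
    have hA : jets v m (A : Form) = 0 := congrArg Prod.fst (LinearMap.mem_ker.1 hx)
    have hB : jets v μ (B : Form) = 0 := congrArg Prod.snd (LinearMap.mem_ker.1 hx)
    rw [jets_eq_zero_iff] at hA hB
    change jets v k (A * F + B * G : Form) = 0
    rw [jets_eq_zero_iff]
    intro i
    rw [map_add, map_mul, map_mul, pow_add]
    refine Ideal.add_mem _ ?_ (Ideal.mul_mem_mul (hB i) (hm i))
    rw [mul_comm (localExpansion (v i) (A : Form))]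
    exact Ideal.mul_mem_mul (hμ i) (hA i)
  have e1 := finrank_le_finrank_ker_add Θ
  have e2 := Submodule.finrank_mono hker
  have e3 := finrank_ker_comp_le (combination hF hG M) Ψ
  have e4 := finrank_ker_combination_le hF hG hFp hFG M
  have e5 := Ψ.finrank_range_add_finrank_ker
  rw [LinearMap.range_eq_top.2 (jets_surjective v k h0 h1 (by omega)), finrank_top, finrank_jets,
    finrank_homogeneousSubmodule] at e5
  rw [Module.finrank_prod, Module.finrank_prod, finrank_jets, finrank_jets,
    finrank_homogeneousSubmodule, finrank_homogeneousSubmodule] at e1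
  have e6 : (M + e + 2).choose 2 + (M + δ + 2).choose 2 + ∑ i, (k i + 1).choose 2 ≤
      (M + 2).choose 2 + (M + δ + e + 2).choose 2 +
        (∑ i, (m i + 1).choose 2 + ∑ i, (μ i + 1).choose 2) := by omega
  -- The excess of the jets of order `μ + m` over those of orders `μ` and `m` is `μ m`. Likewise `δ
  -- e` is the second difference of the dimensions of spaces of forms, so the inequality of
  -- dimensions becomes the claim.
  have e7 : ∑ i, (k i + 1).choose 2 = ∑ i, μ i * m i + (∑ i, (m i + 1).choose 2 +
      ∑ i, (μ i + 1).choose 2) := by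
    rw [← Finset.sum_add_distrib, ← Finset.sum_add_distrib]
    refine Finset.sum_congr rfl fun i _ => ?_
    have : (((k i + 1).choose 2 : ℕ) : ℚ) =
        ((μ i * m i + ((m i + 1).choose 2 + (μ i + 1).choose 2) : ℕ) : ℚ) := by
      push_cast [choose_two_cast, k]
      ring
    exact_mod_cast this
  have e8 : (M + 2).choose 2 + (M + δ + e + 2).choose 2 =
      (M + e + 2).choose 2 + (M + δ + 2).choose 2 + δ * e := by
    have : (((M + 2).choose 2 + (M + δ + e + 2).choose 2 : ℕ) : ℚ) =
        ((M + e + 2).choose 2 + (M + δ + 2).choose 2 + δ * e : ℕ) := by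
      have h := choose_two_cast
      have a1 := h (M + 1)
      have a2 := h (M + δ + e + 1)
      have a3 := h (M + e + 1)
      have a4 := h (M + δ + 1)
      push_cast at a1 a2 a3 a4 ⊢
      rw [a1, a2, a3, a4]
      ring
    exact_mod_cast this
  omega

/-- The points lie in the affine chart given by the first coordinate, and their second affine
coordinates are distinct. -/
def InChart {ι : Type*} (p : ι → Plane) : Prop :=
  (∀ i, (p i).rep 0 ≠ 0) ∧
    ∀ i j, i ≠ j → (p i).rep 1 * (p j).rep 0 ≠ (p j).rep 1 * (p i).rep 0

theorem inter_strictClass_nonneg {n : ℕ} {p : Fin (n + 1) → Plane} (hp : InChart p)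
    (hF : F.IsHomogeneous F.totalDegree) (hG : G.IsHomogeneous G.totalDegree) (hFi : Irreducible F)
    (hFG : ¬ F ∣ G) : 0 ≤ (strictClass p F).inter (strictClass p G) := by
  have hG0 : G ≠ 0 := by
    rintro rfl
    exact hFG (dvd_zero F)
  have h := sum_mul_le_mul (fun i => (p i).rep) hp.1 hp.2 hF hG hFi.prime hFG
    (fun i => multAt F (p i)) (fun i => multAt G (p i))
    (fun i => localExpansion_mem ((le_multAt_iff hFi.ne_zero).1 le_rfl))
    (fun i => localExpansion_mem ((le_multAt_iff hG0).1 le_rfl))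
  simp only [DivisorClass.inter, strictClass]
  zify at h
  linarith

end Bezout

/-! ### Calculus of general points -/

section GeneralPoints

variable {k : ℕ}

theorem ForGeneralPoints.mono {P Q : (Fin k → Plane) → Prop} (h : ForGeneralPoints P)
    (hPQ : ∀ p, P p → Q p) : ForGeneralPoints Q := by
  obtain ⟨Φ, h0, h⟩ := h
  exact ⟨Φ, h0, fun v hv hΦ => hPQ _ (h v hv hΦ)⟩

theorem ForGeneralPoints.of_forall {P : (Fin k → Plane) → Prop} (h : ∀ p, P p) :
    ForGeneralPoints P :=
  ⟨1, one_ne_zero, fun _ _ _ => h _⟩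

theorem ForGeneralPoints.forall_fintype {ι : Type*} [Finite ι] {P : ι → (Fin k → Plane) → Prop}
    (h : ∀ i, ForGeneralPoints (P i)) : ForGeneralPoints fun p => ∀ i, P i p := by
  cases nonempty_fintype ι
  choose Φ h0 h using h
  refine ⟨∏ i, Φ i, Finset.prod_ne_zero_iff.2 fun i _ => h0 i, fun v hv hΦ i => h i v hv ?_⟩
  rw [map_prod] at hΦ
  exact Finset.prod_ne_zero_iff.1 hΦ i (Finset.mem_univ i)

theorem ForGeneralPoints.and {P Q : (Fin k → Plane) → Prop} (hP : ForGeneralPoints P)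
    (hQ : ForGeneralPoints Q) : ForGeneralPoints fun p => P p ∧ Q p := by
  obtain ⟨Φ, h0, h⟩ := hP
  obtain ⟨Ψ, h0', h'⟩ := hQ
  refine ⟨Φ * Ψ, mul_ne_zero h0 h0', fun v hv hΦ => ?_⟩
  rw [map_mul] at hΦ
  exact ⟨h v hv (left_ne_zero_of_mul hΦ), h' v hv (right_ne_zero_of_mul hΦ)⟩

theorem forGeneralPoints_inChart : ForGeneralPoints (InChart : (Fin k → Plane) → Prop) := by
  have hrep : ∀ (w : Fin 3 → ℂ) (hw : w ≠ 0), ∃ a : ℂ, a ≠ 0 ∧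
      ∀ j, (Projectivization.mk ℂ w hw).rep j = a * w j := by
    intro w hw
    obtain ⟨a, ha⟩ := Projectivization.exists_smul_eq_mk_rep ℂ w hw
    exact ⟨a, a.ne_zero, fun j => by rw [← ha]; rfl⟩
  refine ForGeneralPoints.and (ForGeneralPoints.forall_fintype fun i => ?_)
    (ForGeneralPoints.forall_fintype fun i => ForGeneralPoints.forall_fintype fun j => ?_)
  · refine ⟨X (i, 0), X_ne_zero _, fun v hv h => ?_⟩
    obtain ⟨a, ha, hr⟩ := hrep (v i) (hv i)
    rw [hr]
    exact mul_ne_zero ha (by simpa using h)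
  · by_cases hij : i = j
    · exact ForGeneralPoints.of_forall fun _ h => absurd hij h
    refine ⟨X (i, 1) * X (j, 0) - X (j, 1) * X (i, 0), fun h => ?_, fun v hv h _ => ?_⟩
    -- At these values the first product is `0` and the second is `1`, so the polynomial takes the
    -- value `-1`.
    · have := congrArg (eval fun x => if x = (j, 1) ∨ x.2 = 0 then (1 : ℂ) else 0) h
      simp [hij] at this
    · obtain ⟨a, ha, hra⟩ := hrep (v i) (hv i)
      obtain ⟨b, hb, hrb⟩ := hrep (v j) (hv j)
      simp only [hra, hrb]
      simp only [map_sub, map_mul, eval_X, ne_eq, sub_eq_zero] at h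
      intro h'
      apply h
      apply mul_left_cancel₀ (mul_ne_zero ha hb)
      linear_combination h'

end GeneralPoints

/-! ### Non-emptiness of linear systems at general points -/

section Members

variable {k : ℕ}

/-- The linear system of curves of degree `a` with multiplicity at least `α i` at `p i` is not
empty. -/
def HasMember (p : Fin k → Plane) (a : ℕ) (α : Fin k → ℕ) : Prop :=
  ∃ F : Form, F ≠ 0 ∧ F.IsHomogeneous a ∧ ∀ i, α i ≤ multAt F (p i)

/-- The exponents of the monomials of degree less than `m` in three variables. -/
def taylorIndex (m : ℕ) : Finset (Fin 3 →₀ ℕ) :=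
  (Finset.range m).biUnion fun j => Finset.univ.finsuppAntidiag j

theorem mem_taylorIndex {m : ℕ} {s : Fin 3 →₀ ℕ} : s ∈ taylorIndex m ↔ s.degree < m := by
  simp only [taylorIndex, Finset.mem_biUnion, Finset.mem_range, mem_finsuppAntidiag_univ]
  exact ⟨fun ⟨j, hj, h⟩ => h ▸ hj, fun h => ⟨_, h, rfl⟩⟩

/-- The Taylor expansion of a form at the `i`-th of `k` points with indeterminate coordinates. -/
def universalShift (i : Fin k) : Form →ₐ[ℂ] MvPolynomial (Fin 3) (MvPolynomial (Fin k × Fin 3) ℂ) :=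
  aeval fun j => X j + C (X (i, j))

theorem map_eval_universalShift (v : Fin k → Fin 3 → ℂ) (i : Fin k) (F : Form) :
    map (eval fun x => v x.1 x.2) (universalShift i F) = taylorShift (v i) F := by
  have : (map (eval fun x => v x.1 x.2)).comp (universalShift i : Form →ₐ[ℂ] _).toRingHom =
      (taylorShift (v i)).toRingHom := by
    apply MvPolynomial.ringHom_ext
    · intro r
      simp [universalShift, taylorShift, MvPolynomial.algebraMap_apply]
    · intro j
      simp [universalShift, taylorShift]
  exact DFunLike.congr_fun this F

/-- The matrix of the linear conditions on the coefficients of a form of degree `a` that express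
that it has multiplicity at least `α i` at the `i`-th of `k` points with indeterminate
coordinates. -/
def conditionMatrix (a : ℕ) (α : Fin k → ℕ) : Matrix (Σ i, taylorIndex (α i))
    ((Finset.univ : Finset (Fin 3)).finsuppAntidiag a) (MvPolynomial (Fin k × Fin 3) ℂ) :=
  fun x s => coeff (x.2 : Fin 3 →₀ ℕ) (universalShift x.1 (monomial (s : Fin 3 →₀ ℕ) 1))

theorem conditionMatrix_mulVec (a : ℕ) (α : Fin k → ℕ) (v : Fin k → Fin 3 → ℂ)
    (c : (Finset.univ : Finset (Fin 3)).finsuppAntidiag a → ℂ) (x : Σ i, taylorIndex (α i)) :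
    ((conditionMatrix a α).map (eval fun x => v x.1 x.2)).mulVec c x =
      coeff (x.2 : Fin 3 →₀ ℕ) (taylorShift (v x.1)
        (∑ s : (Finset.univ : Finset (Fin 3)).finsuppAntidiag a,
          monomial (s : Fin 3 →₀ ℕ) (c s))) := by
  rw [map_sum, coeff_sum]
  refine Finset.sum_congr rfl fun s _ => ?_
  change eval (fun x => v x.1 x.2) (coeff (x.2 : Fin 3 →₀ ℕ)
    (universalShift x.1 (monomial (s : Fin 3 →₀ ℕ) 1))) * c s = _
  rw [← coeff_map, map_eval_universalShift, mul_comm, ← smul_eq_mul, ← coeff_smul, ← map_smul, smul_monomial, smul_eq_mul, mul_one]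

/-- Non-emptiness becomes a nontrivial kernel of a matrix whose entries are polynomials in the
coordinates of the points, so that determinants can express it. -/
theorem hasMember_mk_iff (a : ℕ) (α : Fin k → ℕ) (v : Fin k → Fin 3 → ℂ) (hv : ∀ i, v i ≠ 0) :
    HasMember (fun i => Projectivization.mk ℂ (v i) (hv i)) a α ↔
      ∃ c ≠ 0, ((conditionMatrix a α).map (eval fun x => v x.1 x.2)).mulVec c = 0 := by
  have hzero : ∀ c, ((conditionMatrix a α).map (eval fun x => v x.1 x.2)).mulVec c = 0 ↔
      ∀ i, taylorShift (v i) (∑ s : (Finset.univ : Finset (Fin 3)).finsuppAntidiag a,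
        monomial (s : Fin 3 →₀ ℕ) (c s)) ∈ idealOfVars (Fin 3) ℂ ^ α i := by
    intro c
    simp only [mem_pow_idealOfVars_iff']
    constructor
    · intro h i s hs
      have := congrFun h ⟨i, s, mem_taylorIndex.2 hs⟩
      rwa [conditionMatrix_mulVec] at this
    · intro h
      funext ⟨i, s, hs⟩
      rw [conditionMatrix_mulVec]
      exact h i s (mem_taylorIndex.1 hs)
  let coeffEquiv := LinearEquiv.ofBijective _ (coeffMap_bijective a)
  have hsum : ∀ F : homogeneousSubmodule (Fin 3) ℂ a,
      ∑ s : (Finset.univ : Finset (Fin 3)).finsuppAntidiag a,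
        monomial (s : Fin 3 →₀ ℕ) (coeffEquiv F s) = (F : Form) := by
    intro F
    ext t
    rw [coeff_sum]
    by_cases ht : t.degree = a
    · rw [Finset.sum_eq_single ⟨t, mem_finsuppAntidiag_univ.2 ht⟩]
      · rw [coeff_monomial, if_pos rfl]
        rfl
      · intro s _ hs
        rw [coeff_monomial, if_neg fun h => hs (Subtype.ext h)]
      · simp
    · rw [IsHomogeneous.coeff_eq_zero F.2 ht]
      refine Finset.sum_eq_zero fun s _ => ?_
      rw [coeff_monomial, if_neg]
      rintro rfl
      exact ht (mem_finsuppAntidiag_univ.1 s.2)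
  constructor
  · rintro ⟨F, hF0, hF, hmult⟩
    refine ⟨coeffEquiv ⟨F, hF⟩, ?_, ?_⟩
    · rw [ne_eq, LinearEquiv.map_eq_zero_iff]
      exact fun h => hF0 (congrArg Subtype.val h)
    · rw [hzero]
      intro i
      rw [hsum]
      exact (le_multAt_mk_iff hF0 hF (hv i)).1 (hmult i)
  · rintro ⟨c, hc0, hc⟩
    obtain ⟨F, rfl⟩ := coeffEquiv.surjective c
    have hF0 : (F : Form) ≠ 0 := by
      intro h
      apply hc0
      rw [show F = 0 from Subtype.ext h, map_zero]
    rw [hzero] at hc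
    refine ⟨F, hF0, F.2, fun i => (le_multAt_mk_iff hF0 F.2 (hv i)).2 ?_⟩
    rw [← hsum]
    exact hc i

/-- Emptiness of a linear system is an open condition on the base points. -/
theorem forGeneralPoints_not_hasMember {q : Fin k → Plane} {a : ℕ} {α : Fin k → ℕ}
    (hq : ¬ HasMember q a α) : ForGeneralPoints fun p => ¬ HasMember p a α := by
  let w : Fin k → Fin 3 → ℂ := fun i => (q i).rep
  have hw : ∀ i, w i ≠ 0 := fun i => (q i).rep_nonzero
  have hqw : q = fun i => Projectivization.mk ℂ (w i) (hw i) := by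
    funext i
    exact ((q i).mk_rep).symm
  rw [hqw, hasMember_mk_iff] at hq
  let M := (conditionMatrix a α).map (eval fun x => w x.1 x.2)
  have hker : LinearMap.ker (Matrix.toLin' M) = ⊥ := by
    rw [LinearMap.ker_eq_bot']
    intro c hc
    by_contra h
    exact hq ⟨c, h, by simpa using hc⟩
  -- A constant left inverse `N` of the matrix at `q` singles out the open condition `det (N *
  -- conditionMatrix) ≠ 0`. The determinant is `1` at `q`, and wherever it is nonzero the kernel is
  -- trivial.
  obtain ⟨L, hL⟩ := LinearMap.exists_leftInverse_of_injective _ hker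
  obtain ⟨N, hN⟩ : ∃ N : Matrix ((Finset.univ : Finset (Fin 3)).finsuppAntidiag a)
      (Σ i, taylorIndex (α i)) ℂ, N * M = 1 := by
    refine ⟨LinearMap.toMatrix' L, ?_⟩
    have := congrArg LinearMap.toMatrix' hL
    rwa [LinearMap.toMatrix'_comp, LinearMap.toMatrix'_toLin', LinearMap.toMatrix'_id] at this
  let NC : Matrix ((Finset.univ : Finset (Fin 3)).finsuppAntidiag a)
      (Σ i, taylorIndex (α i)) (MvPolynomial (Fin k × Fin 3) ℂ) := N.map C
  let Φ := Matrix.det (NC * conditionMatrix a α)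
  have heval : ∀ v : Fin k → Fin 3 → ℂ, eval (fun x => v x.1 x.2) Φ =
      Matrix.det (N * (conditionMatrix a α).map (eval fun x => v x.1 x.2)) := by
    intro v
    rw [RingHom.map_det, RingHom.mapMatrix_apply, Matrix.map_mul]
    congr 2
    ext i j
    simp [NC]
  refine ⟨Φ, fun h => ?_, fun v hv hΦ => ?_⟩
  · have := heval w
    rw [hN, h] at this
    simp at this
  · change ¬ HasMember _ a α
    rw [hasMember_mk_iff]
    rintro ⟨c, hc0, hc⟩
    rw [heval] at hΦ
    apply hc0
    apply Matrix.eq_zero_of_mulVec_eq_zero hΦ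
    rw [← Matrix.mulVec_mulVec, hc, Matrix.mulVec_zero]

/-- The linear systems with multiplicities and degree at most `d` that have a member for the
points `p` have one for all points. -/
theorem forGeneralPoints_hasMember (k d : ℕ) : ForGeneralPoints fun p : Fin k → Plane =>
    ∀ a ≤ d, ∀ α : Fin k → ℕ, (∀ i, α i ≤ d) → HasMember p a α → ∀ q, HasMember q a α := by
  -- The bound `d` leaves finitely many systems, hence a finite intersection of open sets.
  have h : ForGeneralPoints fun p : Fin k → Plane => ∀ (a : Fin (d + 1)) (α : Fin k → Fin (d + 1)),
      HasMember p a (fun i => α i) → ∀ q, HasMember q a fun i => α i := by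
    refine ForGeneralPoints.forall_fintype fun a => ForGeneralPoints.forall_fintype fun α => ?_
    -- Either the system has a member at all points, or it is empty at some `q` and then at general
    -- points.
    by_cases hall : ∀ q : Fin k → Plane, HasMember q a fun i => α i
    · exact ForGeneralPoints.of_forall fun _ _ => hall
    · push Not at hall
      obtain ⟨q, hq⟩ := hall
      exact (forGeneralPoints_not_hasMember hq).mono fun p hp h => absurd h hp
  refine h.mono fun p hp a ha α hα => ?_
  exact hp ⟨a, by omega⟩ fun i => ⟨α i, by have := hα i; omega⟩

end Members

/-! ### Irreducible curves of self-intersection `-1` -/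

section NegativeCurves

variable {n : ℕ} {p : Fin (n + 1) → Plane} {F G H : Form}

theorem inter_strictClass_mul (hF : F ≠ 0) (hG : G ≠ 0) (D : DivisorClass n) :
    (strictClass p (F * G)).inter D = (strictClass p F).inter D + (strictClass p G).inter D := by
  simp only [DivisorClass.inter, strictClass, totalDegree_mul_of_isDomain hF hG, multAt_mul hF hG,
    Nat.cast_add, add_mul, Finset.sum_add_distrib]
  ring

theorem inter_strictClass_pow (hF : F ≠ 0) (a : ℕ) (D : DivisorClass n) :
    (strictClass p (F ^ a)).inter D = a * (strictClass p F).inter D := by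
  induction a with
  | zero =>
    have hdeg : (1 : Form).totalDegree = 0 := totalDegree_one
    have hmult : ∀ q, multAt (1 : Form) q = 0 := multAt_isUnit isUnit_one
    simp [DivisorClass.inter, strictClass, hdeg, hmult]
  | succ a ih =>
    rw [pow_succ, inter_strictClass_mul (pow_ne_zero _ hF) hF, ih]
    push_cast
    ring

theorem inter_comm (D D' : DivisorClass n) : D.inter D' = D'.inter D := by
  simp only [DivisorClass.inter, mul_comm]

theorem inter_strictClass_le {D : DivisorClass n} (hH : H ∈ linearSystem p D) (F : Form) :
    (strictClass p H).inter (strictClass p F) ≤ D.inter (strictClass p F) := by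
  obtain ⟨-, -, hdeg, hmult⟩ := hH
  simp only [DivisorClass.inter, strictClass, hdeg]
  refine sub_le_sub_left (Finset.sum_le_sum fun i _ => ?_) _
  exact mul_le_mul_of_nonneg_right (hmult i) (Nat.cast_nonneg _)

/-- An irreducible curve whose strict transform has self-intersection number `-1`. -/
structure IsNegativeCurve (p : Fin (n + 1) → Plane) (F : Form) : Prop where
  irreducible : Irreducible F
  homogeneous : F.IsHomogeneous F.totalDegree
  selfInter : (strictClass p F).inter (strictClass p F) = -1

theorem IsNegativeCurve.dvd_of_inter_neg (hp : InChart p) (hF : IsNegativeCurve p F)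
    (hH : H.IsHomogeneous H.totalDegree)
    (h : (strictClass p H).inter (strictClass p F) < 0) : F ∣ H := by
  by_contra hdvd
  have := inter_strictClass_nonneg hp hF.homogeneous hH hF.irreducible hdvd
  rw [inter_comm] at this
  omega

theorem associated_of_dvd_of_totalDegree_eq (hH : H ≠ 0) (hdvd : F ∣ H)
    (hdeg : H.totalDegree = F.totalDegree) : Associated H F := by
  obtain ⟨R, rfl⟩ := hdvd
  have hF0 := left_ne_zero_of_mul hH
  have hR0 := right_ne_zero_of_mul hH
  rw [totalDegree_mul_of_isDomain hF0 hR0] at hdeg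
  exact associated_mul_unit_left _ _ (isUnit_of_totalDegree_eq_zero hR0 (by omega))

/-- Rigidity: `H·F ≤ F² = -1` forces `F ∣ H`, and the degrees are equal. -/
theorem IsNegativeCurve.associated_of_le (hp : InChart p) (hF : IsNegativeCurve p F) (hH0 : H ≠ 0)
    (hH : H.IsHomogeneous F.totalDegree) (hmult : ∀ i, multAt F (p i) ≤ multAt H (p i)) :
    Associated H F := by
  have hdeg := hH.totalDegree hH0
  rw [← hdeg] at hH
  refine associated_of_dvd_of_totalDegree_eq hH0 (hF.dvd_of_inter_neg hp hH ?_) hdeg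
  have hmem : H ∈ linearSystem p (strictClass p F) :=
    ⟨hH0, hH, by rw [hdeg]; rfl, fun i => Nat.cast_le.2 (hmult i)⟩
  have := inter_strictClass_le hmem F
  rw [hF.selfInter] at this
  omega

/-- Two negative curves that both split off from a curve do not meet. -/
theorem IsNegativeCurve.inter_nonpos (hp : InChart p) (hF : IsNegativeCurve p F)
    (hG : IsNegativeCurve p G) (hH0 : H ≠ 0)
    (hH : H.IsHomogeneous H.totalDegree)
    (hHF : (strictClass p H).inter (strictClass p F) < 0)
    (hHG : (strictClass p H).inter (strictClass p G) < 0) :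
    (strictClass p F).inter (strictClass p G) ≤ 0 := by
  have hF0 := hF.irreducible.ne_zero
  have hG0 := hG.irreducible.ne_zero
  -- Write `H = F ^ a * G ^ b * R` with `R` divisible by neither `F` nor `G`, so that `R·F` and
  -- `R·G` are nonnegative.
  obtain ⟨H', hHH', hFH'⟩ := (FiniteMultiplicity.of_prime_left hF.irreducible.prime
    hH0).exists_eq_pow_mul_and_not_dvd
  generalize multiplicity F H = a at hHH'
  subst hHH'
  have hH'0 := right_ne_zero_of_mul hH0
  obtain ⟨R, hHR, hGR⟩ := (FiniteMultiplicity.of_prime_left hG.irreducible.prime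
    hH'0).exists_eq_pow_mul_and_not_dvd
  generalize multiplicity G H' = b at hHR
  subst hHR
  have hR0 := right_ne_zero_of_mul hH'0
  have hFR : ¬ F ∣ R := fun h => hFH' (dvd_mul_of_dvd_right h _)
  have hR := (hH.of_mul (pow_ne_zero _ hF0) hH'0).2
  have hR := (hR.of_mul (pow_ne_zero _ hG0) hR0).2
  have h1 := inter_strictClass_nonneg hp hF.homogeneous hR hF.irreducible hFR
  have h2 := inter_strictClass_nonneg hp hG.homogeneous hR hG.irreducible hGR
  rw [inter_strictClass_mul (pow_ne_zero _ hF0) hH'0,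
    inter_strictClass_mul (pow_ne_zero _ hG0) hR0, inter_strictClass_pow hF0,
    inter_strictClass_pow hG0] at hHF hHG
  rw [hF.selfInter, inter_comm (strictClass p G)] at hHF
  rw [hG.selfInter] at hHG
  rw [inter_comm] at h1 h2
  -- With `c = F·G ≥ 1`, adding `-a + b c + R·F < 0` and `a c - b + R·G < 0` gives `(a + b)(c - 1) +
  -- R·F + R·G < 0`, which is absurd.
  by_contra! hc
  nlinarith [Int.natCast_nonneg a, Int.natCast_nonneg b,
    mul_le_mul_of_nonneg_left (show 1 ≤ (strictClass p F).inter (strictClass p G) from hc)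
      (Int.natCast_nonneg a),
    mul_le_mul_of_nonneg_left (show 1 ≤ (strictClass p F).inter (strictClass p G) from hc)
      (Int.natCast_nonneg b)]

end NegativeCurves

/-! ### Permuting the multiplicities of a negative curve -/

section Permutations

variable {n d : ℕ} {p : Fin (n + 1) → Plane} {F G H : Form}

/-- The points are general enough with respect to curves of degree at most `d`. -/
structure IsGeneral (d : ℕ) (p : Fin (n + 1) → Plane) : Prop where
  inChart : InChart p
  hasMember : ∀ a ≤ d, ∀ α : Fin (n + 1) → ℕ, (∀ i, α i ≤ d) →
    HasMember p a α → ∀ q, HasMember q a α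

theorem IsGeneral.exists_permuted (h : IsGeneral d p) (hF0 : F ≠ 0)
    (hF : F.IsHomogeneous F.totalDegree) (hd : F.totalDegree ≤ d)
    (ρ : Equiv.Perm (Fin (n + 1))) :
    ∃ E : Form, E ≠ 0 ∧ E.IsHomogeneous F.totalDegree ∧
      ∀ i, multAt F (p (ρ i)) ≤ multAt E (p i) := by
  -- The system of `F` is non-empty at `p`, hence also at the tuple `p ∘ ρ⁻¹`; reindexing gives the
  -- permuted multiplicities at `p`.
  obtain ⟨E, hE0, hE, hmult⟩ := h.hasMember F.totalDegree hd (fun i => multAt F (p i))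
    (fun i => (multAt_le_totalDegree hF0 _).trans hd) ⟨F, hF0, hF, fun _ => le_rfl⟩
    (fun i => p (ρ.symm i))
  exact ⟨E, hE0, hE, fun i => by simpa using hmult (ρ i)⟩

/-- Permuting a member back must return `F`, by rigidity. Hence no multiplicity of `E` can exceed
the prescribed one, and a factorization of `E`, permuted back factor by factor, would be a
factorization of `F`. -/
theorem IsNegativeCurve.exists_permuted (h : IsGeneral d p) (hF : IsNegativeCurve p F)
    (hd : F.totalDegree ≤ d) (ρ : Equiv.Perm (Fin (n + 1))) :
    ∃ E : Form, IsNegativeCurve p E ∧ E.totalDegree = F.totalDegree ∧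
      ∀ i, multAt E (p i) = multAt F (p (ρ i)) := by
  obtain ⟨E, hE0, hE, hmult⟩ := h.exists_permuted hF.irreducible.ne_zero hF.homogeneous hd ρ
  have hdeg := hE.totalDegree hE0
  have hmult' : ∀ i, multAt E (p i) = multAt F (p (ρ i)) := by
    intro i
    apply le_antisymm _ (hmult i)
    rw [← hdeg] at hE hd
    obtain ⟨F', hF'0, hF', hmultF'⟩ := h.exists_permuted hE0 hE hd ρ.symm
    rw [hdeg] at hF'
    have hass := hF.associated_of_le h.inChart hF'0 hF' fun j => by
      simpa using (hmult (ρ.symm j)).trans (hmultF' j)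
    have := hmultF' (ρ i)
    rwa [multAt_associated hass, ρ.symm_apply_apply] at this
  refine ⟨E, ⟨⟨fun hu => ?_, fun A B hAB => ?_⟩, by rwa [hdeg], ?_⟩, hdeg, hmult'⟩
  · apply hF.irreducible.not_isUnit
    apply isUnit_of_totalDegree_eq_zero hF.irreducible.ne_zero
    rw [← hdeg, totalDegree_isUnit hu]
  · rw [hAB] at hE0 hE
    have hA0 := left_ne_zero_of_mul hE0
    have hB0 := right_ne_zero_of_mul hE0
    obtain ⟨hA, hB⟩ := hE.of_mul hA0 hB0
    rw [hAB, totalDegree_mul_of_isDomain hA0 hB0] at hdeg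
    obtain ⟨A', hA'0, hA', hmA⟩ := h.exists_permuted hA0 hA (by omega) ρ.symm
    obtain ⟨B', hB'0, hB', hmB⟩ := h.exists_permuted hB0 hB (by omega) ρ.symm
    have hAB' := hA'.mul hB'
    rw [hdeg] at hAB'
    have hass := hF.associated_of_le h.inChart (mul_ne_zero hA'0 hB'0) hAB' fun i => by
      have h1 := hmult (ρ.symm i)
      rw [hAB, multAt_mul hA0 hB0, ρ.apply_symm_apply] at h1
      rw [multAt_mul hA'0 hB'0]
      exact h1.trans (add_le_add (hmA i) (hmB i))
    rcases (hass.irreducible_iff.2 hF.irreducible).isUnit_or_isUnit rfl with hu | hu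
    · left
      apply isUnit_of_totalDegree_eq_zero hA0
      rw [← hA'.totalDegree hA'0, totalDegree_isUnit hu]
    · right
      apply isUnit_of_totalDegree_eq_zero hB0
      rw [← hB'.totalDegree hB'0, totalDegree_isUnit hu]
  · rw [← hF.selfInter]
    simp only [DivisorClass.inter, strictClass, hdeg, hmult']
    rw [Equiv.sum_comp ρ fun i => (multAt F (p i) : ℤ) * multAt F (p i)]

/-- The permutation of `{0, …, n}` that fixes `0` and acts on the other elements as `σ`. -/
def extendPerm (σ : Equiv.Perm (Fin n)) : Equiv.Perm (Fin (n + 1)) :=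
  Equiv.Perm.decomposeFin.symm (0, σ)

theorem extendPerm_zero (σ : Equiv.Perm (Fin n)) : extendPerm σ 0 = 0 := by
  simp [extendPerm]

theorem extendPerm_succ (σ : Equiv.Perm (Fin n)) (i : Fin n) :
    extendPerm σ i.succ = (σ i).succ := by
  simp [extendPerm]

theorem strictClass_permute_mult (σ : Equiv.Perm (Fin n)) (i : Fin (n + 1)) :
    ((strictClass p F).permute σ).mult i = multAt F (p (extendPerm σ i)) := by
  refine Fin.cases ?_ (fun i => ?_) i
  · rw [extendPerm_zero]
    rfl
  · rw [extendPerm_succ]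
    rfl

theorem IsNegativeCurve.isSoleMember_permute (hp : InChart p) (hG : IsNegativeCurve p G)
    {σ : Equiv.Perm (Fin n)} (hdeg : G.totalDegree = F.totalDegree)
    (hmult : ∀ i, multAt G (p i) = multAt F (p (extendPerm σ i))) :
    IsSoleMember p ((strictClass p F).permute σ) G := by
  refine ⟨⟨hG.irreducible.ne_zero, hG.homogeneous, by rw [hdeg]; rfl, fun i => ?_⟩, ?_⟩
  · rw [strictClass_permute_mult, hmult]
  · rintro H ⟨hH0, hH, hHdeg, hHmult⟩
    have hHdeg' : H.totalDegree = G.totalDegree := by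
      rw [hdeg]
      exact Nat.cast_injective hHdeg
    rw [hHdeg'] at hH
    refine hG.associated_of_le hp hH0 hH fun i => ?_
    have := hHmult i
    rw [strictClass_permute_mult, ← hmult] at this
    exact Nat.cast_le.1 this

theorem IsNegativeCurve.of_associated (hF : IsNegativeCurve p F) (h : Associated F G) :
    IsNegativeCurve p G := by
  obtain ⟨u, rfl⟩ := id h
  have hFu : strictClass p (F * u) = strictClass p F := by
    simp only [strictClass, multAt_associated h, totalDegree_associated h]
  refine ⟨h.irreducible_iff.1 hF.irreducible, ?_, by rw [hFu, hF.selfInter]⟩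
  have := hF.homogeneous.mul ((totalDegree_zero_iff_isHomogeneous _).1 (totalDegree_isUnit u.isUnit))
  rwa [add_zero, totalDegree_associated h] at this

/-- The permuted negative curve lies in the system, so it is the sole member up to a constant. This
gives irreducibility and exact multiplicities for any choice of the components of `C_tot`. -/
theorem IsNegativeCurve.of_isSoleMember (h : IsGeneral d p) (hF : IsNegativeCurve p F)
    (hd : F.totalDegree ≤ d) {σ : Equiv.Perm (Fin n)}
    (hG : IsSoleMember p ((strictClass p F).permute σ) G) :
    IsNegativeCurve p G ∧ G.totalDegree = F.totalDegree ∧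
      ∀ i, multAt G (p i) = multAt F (p (extendPerm σ i)) := by
  obtain ⟨E, hE, hdeg, hmult⟩ := hF.exists_permuted h hd (extendPerm σ)
  have hass := hG.2 E (hE.isSoleMember_permute h.inChart hdeg hmult).1
  refine ⟨hE.of_associated hass, ?_, fun i => ?_⟩
  · rw [← totalDegree_associated hass, hdeg]
  · rw [← multAt_associated hass, hmult]

end Permutations

/-! ### Multiplicity vectors that are nearly invariant under permutations -/

section Combinatorics

/-- A transposition contributes `2 (μ_i - μ_j)²`, so the values differ by at most one. If two values
both occurred twice, exchanging two disjoint pairs of unequal entries would give `4`. -/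
theorem eq_const_or_eq_const_except_one {n : ℕ} (μ : Fin n → ℕ)
    (h : ∀ σ : Equiv.Perm (Fin n), ∑ i, ((μ i : ℤ) - μ (σ i)) ^ 2 ≤ 2) :
    (∃ ν, ∀ i, μ i = ν) ∨
      (∃ (ν : ℕ) (i₀ : Fin n), (μ i₀ : ℤ) = ν - 1 ∧ ∀ i, i ≠ i₀ → μ i = ν) ∨
      ∃ (ν : ℕ) (i₀ : Fin n), (μ i₀ : ℤ) = ν + 1 ∧ ∀ i, i ≠ i₀ → μ i = ν := by
  have hsub : ∀ (σ : Equiv.Perm (Fin n)) (s : Finset (Fin n)),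
      ∑ i ∈ s, ((μ i : ℤ) - μ (σ i)) ^ 2 ≤ 2 := fun σ s =>
    (Finset.sum_le_univ_sum_of_nonneg fun i => sq_nonneg _).trans (h σ)
  have hclose : ∀ i j, (μ i : ℤ) ≤ μ j + 1 := by
    intro i j
    by_cases hij : i = j
    · rw [hij]
      omega
    have := hsub (Equiv.swap i j) {i, j}
    rw [Finset.sum_pair hij, Equiv.swap_apply_left, Equiv.swap_apply_right] at this
    by_contra! hlt
    nlinarith
  by_cases hconst : ∀ i j, μ i = μ j
  · left
    rcases isEmpty_or_nonempty (Fin n) with hn | ⟨⟨i⟩⟩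
    · exact ⟨0, fun i => hn.elim i⟩
    · exact ⟨μ i, fun j => hconst j i⟩
  right
  obtain ⟨a, b, hab⟩ : ∃ a b, μ a = μ b + 1 := by
    push Not at hconst
    obtain ⟨i, j, hij⟩ := hconst
    have h1 := hclose i j
    have h2 := hclose j i
    rcases lt_or_gt_of_ne hij with hlt | hlt
    · exact ⟨j, i, by omega⟩
    · exact ⟨i, j, by omega⟩
  have htwo : ∀ i, μ i = μ b ∨ μ i = μ a := by
    intro i
    have h1 := hclose i b
    have h2 := hclose a i
    omega
  by_cases hb : ∀ i, i ≠ b → μ i = μ a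
  · exact Or.inl ⟨μ a, b, by omega, hb⟩
  by_cases ha : ∀ i, i ≠ a → μ i = μ b
  · exact Or.inr ⟨μ b, a, by omega, ha⟩
  exfalso
  push Not at ha hb
  obtain ⟨j, hjb, hj⟩ := hb
  obtain ⟨l, hla, hl⟩ := ha
  replace hj := (htwo j).resolve_right hj
  replace hl := (htwo l).resolve_left hl
  have hba : b ≠ a := by rintro rfl; omega
  have hja : j ≠ a := by rintro rfl; omega
  have hlb : l ≠ b := by rintro rfl; omega
  have hlj : l ≠ j := by rintro rfl; omega
  -- Here `μ a = μ l = μ b + 1` and `μ j = μ b`, so each of the four indices contributes `1`.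
  have := hsub (Equiv.swap a b * Equiv.swap l j) {a, b, l, j}
  rw [Finset.sum_insert (by simp [hba.symm, hla.symm, hja.symm]),
    Finset.sum_insert (by simp [hlb.symm, hjb.symm]), Finset.sum_pair hlj] at this
  simp only [Equiv.Perm.mul_apply, Equiv.swap_apply_left, Equiv.swap_apply_right,
    Equiv.swap_apply_of_ne_of_ne hla.symm hja.symm, Equiv.swap_apply_of_ne_of_ne hlb.symm hjb.symm,
    Equiv.swap_apply_of_ne_of_ne hja hjb, Equiv.swap_apply_of_ne_of_ne hla hlb, hj, hl, hab]
    at this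
  push_cast at this
  nlinarith

end Combinatorics

/-! ### The total curve as the only member of its system -/

section TotalCurve

variable {n d : ℕ} {p : Fin (n + 1) → Plane} {F G : Form}

theorem totalDegree_prod_of_ne_zero {ι : Type*} (A : Finset ι) (E : ι → Form)
    (h : ∀ i ∈ A, E i ≠ 0) : (∏ i ∈ A, E i).totalDegree = ∑ i ∈ A, (E i).totalDegree := by
  classical
  induction A using Finset.induction_on with
  | empty => simp
  | insert a A ha ih =>
    have hA : ∀ i ∈ A, E i ≠ 0 := fun i hi => h i (Finset.mem_insert_of_mem hi)
    rw [Finset.prod_insert ha, Finset.sum_insert ha, totalDegree_mul_of_isDomain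
      (h a (Finset.mem_insert_self a A)) (Finset.prod_ne_zero_iff.2 hA), ih hA]

theorem multAt_prod {ι : Type*} (A : Finset ι) (E : ι → Form) (h : ∀ i ∈ A, E i ≠ 0) (q : Plane) :
    multAt (∏ i ∈ A, E i) q = ∑ i ∈ A, multAt (E i) q := by
  classical
  induction A using Finset.induction_on with
  | empty => simpa using multAt_isUnit isUnit_one q
  | insert a A ha ih =>
    have hA : ∀ i ∈ A, E i ≠ 0 := fun i hi => h i (Finset.mem_insert_of_mem hi)
    rw [Finset.prod_insert ha, Finset.sum_insert ha, multAt_mul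
      (h a (Finset.mem_insert_self a A)) (Finset.prod_ne_zero_iff.2 hA), ih hA]

theorem prod_dvd_of_irreducible {ι : Type*} (A : Finset ι) (E : ι → Form)
    (hE : ∀ i ∈ A, Irreducible (E i))
    (hA : (A : Set ι).Pairwise fun i j => ¬ Associated (E i) (E j)) {H : Form}
    (hH : ∀ i ∈ A, E i ∣ H) : ∏ i ∈ A, E i ∣ H := by
  refine Finset.prod_dvd_of_isRelPrime (fun i hi j hj hij => ?_) hH
  refine (hE i hi).isRelPrime_iff_not_dvd.2 fun hdvd => ?_
  exact hA hi hj hij ((hE i hi).associated_of_dvd (hE j hj) hdvd)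

/-- The permuted multiplicity vector is determined by the position `σ⁻¹(i₀)` of its odd entry, and a
negative curve by its class. The sign `ε` treats both exceptional cases together. -/
theorem associated_iff_symm_apply_eq (h : IsGeneral d p) (hF : IsNegativeCurve p F)
    (hd : F.totalDegree ≤ d) {i₀ : Fin n} {ν : ℕ} {ε : ℤ} (hε : ε ^ 2 = 1)
    (hi₀ : (multAt F (p i₀.succ) : ℤ) = ν + ε)
    (hi : ∀ i, i ≠ i₀ → multAt F (p i.succ) = ν)
    {E : Equiv.Perm (Fin n) → Form}
    (hE : ∀ σ, IsSoleMember p ((strictClass p F).permute σ) (E σ)) (σ τ : Equiv.Perm (Fin n)) :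
    Associated (E σ) (E τ) ↔ σ.symm i₀ = τ.symm i₀ := by
  have hEσ := fun σ => hF.of_isSoleMember h hd (hE σ)
  have hmult : ∀ i, (multAt F (p (Fin.succ i)) : ℤ) = ν + if i = i₀ then ε else 0 := by
    intro i
    split_ifs with hii
    · rw [hii, hi₀]
    · rw [hi i hii, add_zero]
  have hε0 : ε ≠ 0 := by
    rintro rfl
    simp at hε
  constructor
  · intro hass
    have h1 := multAt_associated hass (p (σ.symm i₀).succ)
    rw [(hEσ σ).2.2, (hEσ τ).2.2, extendPerm_succ, extendPerm_succ, σ.apply_symm_apply] at h1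
    have h2 := hmult (τ (σ.symm i₀))
    rw [← h1, hi₀] at h2
    by_contra hne
    rw [if_neg fun h' => hne (τ.eq_symm_apply.2 h')] at h2
    omega
  · intro hστ
    refine (hEσ τ).1.associated_of_le h.inChart (hEσ σ).1.irreducible.ne_zero ?_ fun i => ?_
    · rw [(hEσ τ).2.1, ← (hEσ σ).2.1]
      exact (hEσ σ).1.homogeneous
    · rw [(hEσ σ).2.2, (hEσ τ).2.2]
      refine Fin.cases ?_ (fun i => ?_) i
      · rw [extendPerm_zero, extendPerm_zero]
      · rw [extendPerm_succ, extendPerm_succ]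
        have e1 := hmult (σ i)
        have e2 := hmult (τ i)
        have e3 : σ i = i₀ ↔ τ i = i₀ := by
          rw [← Equiv.eq_symm_apply, ← Equiv.eq_symm_apply, hστ]
        simp only [e3] at e1
        omega

/-- A maximal `A` has exactly one permutation for each position of the odd entry: if position `k`
were missing, `Equiv.swap k i₀` could be added. -/
theorem injOn_and_image_eq_univ_of_maximal {i₀ : Fin n} {E : Equiv.Perm (Fin n) → Form}
    (hE : ∀ σ τ, Associated (E σ) (E τ) ↔ σ.symm i₀ = τ.symm i₀)
    {A : Finset (Equiv.Perm (Fin n))}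
    (hA : Maximal (fun B : Finset (Equiv.Perm (Fin n)) =>
      (B : Set (Equiv.Perm (Fin n))).Pairwise fun σ τ => ¬ Associated (E σ) (E τ)) A) :
    Set.InjOn (fun σ : Equiv.Perm (Fin n) => σ.symm i₀) A ∧
      A.image (fun σ : Equiv.Perm (Fin n) => σ.symm i₀) = Finset.univ := by
  constructor
  · intro σ hσ τ hτ hστ
    by_contra hne
    exact hA.1 hσ hτ hne ((hE σ τ).2 hστ)
  · rw [Finset.eq_univ_iff_forall]
    intro k
    by_contra hk
    have hk' : ∀ σ ∈ A, σ.symm i₀ ≠ k := fun σ hσ h =>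
      hk (Finset.mem_image.2 ⟨σ, hσ, h⟩)
    have hswap : (Equiv.swap k i₀).symm i₀ = k := by simp
    have hins : ((insert (Equiv.swap k i₀) A : Finset (Equiv.Perm (Fin n))) :
        Set (Equiv.Perm (Fin n))).Pairwise fun σ τ => ¬ Associated (E σ) (E τ) := by
      rw [Finset.coe_insert]
      refine hA.1.insert fun τ hτ _ => ?_
      rw [hE, hE, hswap]
      exact ⟨(hk' τ hτ).symm, hk' τ hτ⟩
    exact hk' _ (hA.2 hins (Finset.subset_insert _ _) (Finset.mem_insert_self _ _)) hswap

theorem exists_isTotalCurve (h : IsGeneral d p) (hF : IsNegativeCurve p F)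
    (hd : F.totalDegree ≤ d) : ∃ G, IsTotalCurve p F G := by
  choose E hE hdeg hmult using fun σ : Equiv.Perm (Fin n) =>
    hF.exists_permuted h hd (extendPerm σ)
  obtain ⟨A, -, hA⟩ := (Set.toFinite {B : Finset (Equiv.Perm (Fin n)) |
    (B : Set (Equiv.Perm (Fin n))).Pairwise fun σ τ => ¬ Associated (E σ) (E τ)}).exists_le_maximal
    (a := ∅) (by simp)
  exact ⟨∏ σ ∈ A, E σ, E, A,
    fun σ => (hE σ).isSoleMember_permute h.inChart (hdeg σ) (hmult σ), hA, rfl⟩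

theorem totalCurveIs_quasiHom (h : IsGeneral d p) (hF : IsNegativeCurve p F)
    (hd : F.totalDegree ≤ d) {i₀ : Fin n} {ν : ℕ} {ε : ℤ} (hε : ε ^ 2 = 1)
    (hi₀ : (multAt F (p i₀.succ) : ℤ) = ν + ε)
    (hi : ∀ i, i ≠ i₀ → multAt F (p i.succ) = ν) :
    TotalCurveIs p F (quasiHom n (n * F.totalDegree) (n * multAt F (p 0)) (n * ν + ε)) := by
  refine ⟨exists_isTotalCurve h hF hd, ?_⟩
  rintro G ⟨E, A, hE, hA, rfl⟩
  have hEσ := fun σ => hF.of_isSoleMember h hd (hE σ)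
  have hE0 : ∀ σ ∈ A, E σ ≠ 0 := fun σ _ => (hEσ σ).1.irreducible.ne_zero
  have hprod0 : ∏ σ ∈ A, E σ ≠ 0 := Finset.prod_ne_zero_iff.2 hE0
  obtain ⟨hinj, himage⟩ := injOn_and_image_eq_univ_of_maximal
    (associated_iff_symm_apply_eq h hF hd hε hi₀ hi hE) hA
  have hmult : ∀ i, (multAt F (p (Fin.succ i)) : ℤ) = ν + if i = i₀ then ε else 0 := by
    intro i
    split_ifs with hii
    · rw [hii, hi₀]
    · rw [hi i hii, add_zero]
  have hsum : ∀ g : Fin n → ℤ, ∑ σ ∈ A, g (σ.symm i₀) = ∑ k, g k := by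
    intro g
    rw [← himage, Finset.sum_image hinj]
  have hcard : (A.card : ℤ) = n := by
    simpa using hsum fun _ => 1
  have hdegG : ((∏ σ ∈ A, E σ).totalDegree : ℤ) = n * F.totalDegree := by
    rw [totalDegree_prod_of_ne_zero A E hE0, Finset.sum_congr rfl fun σ _ => (hEσ σ).2.1,
      Finset.sum_const, ← hcard]
    simp
  have hmultG0 : (multAt (∏ σ ∈ A, E σ) (p 0) : ℤ) = n * multAt F (p 0) := by
    rw [multAt_prod A E hE0, Finset.sum_congr rfl fun σ _ => (hEσ σ).2.2 0]
    simp only [extendPerm_zero, Finset.sum_const, ← hcard]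
    simp
  have hmultG : ∀ i : Fin n, (multAt (∏ σ ∈ A, E σ) (p i.succ) : ℤ) = n * ν + ε := by
    intro i
    rw [multAt_prod A E hE0, Finset.sum_congr rfl fun σ _ => (hEσ σ).2.2 i.succ]
    simp only [extendPerm_succ]
    push_cast
    simp only [hmult]
    -- At each point exactly one of the `n` components has the odd multiplicity.
    have := hsum fun k => ν + if i = k then ε else 0
    simp only [Equiv.eq_symm_apply] at this
    rw [this, Finset.sum_add_distrib]
    simp
  have hhom : (∏ σ ∈ A, E σ).IsHomogeneous (∏ σ ∈ A, E σ).totalDegree := by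
    rw [totalDegree_prod_of_ne_zero A E hE0]
    exact IsHomogeneous.prod _ _ _ fun σ _ => (hEσ σ).1.homogeneous
  refine ⟨⟨hprod0, hhom, hdegG, fun i => ?_⟩, ?_⟩
  · refine Fin.cases ?_ (fun i => ?_) i
    · exact hmultG0.ge
    · exact (hmultG i).ge
  · intro H hH
    have hHdeg : H.totalDegree = (∏ σ ∈ A, E σ).totalDegree := by
      exact_mod_cast hH.2.2.1.trans hdegG.symm
    refine associated_of_dvd_of_totalDegree_eq hH.1 ?_ hHdeg
    refine prod_dvd_of_irreducible A E (fun σ _ => (hEσ σ).1.irreducible) hA.1 fun σ _ => ?_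
    -- Each component splits off from `H`, because the class of the system meets it negatively.
    refine (hEσ σ).1.dvd_of_inter_neg h.inChart hH.2.1 ?_
    refine (inter_strictClass_le hH _).trans_lt ?_
    have hself := hF.selfInter
    simp only [DivisorClass.inter, strictClass, quasiHom, Fin.sum_univ_succ, Fin.cons_zero,
      Fin.cons_succ, (hEσ σ).2.1, (hEσ σ).2.2, extendPerm_zero, extendPerm_succ] at hself ⊢
    rw [← Finset.mul_sum, Equiv.sum_comp σ fun i => (multAt F (p i.succ) : ℤ)]
    have hs1 : ∑ i : Fin n, (multAt F (p i.succ) : ℤ) = n * ν + ε := by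
      simp only [hmult, Finset.sum_add_distrib]
      simp
    have hs2 : ∑ i : Fin n, (multAt F (p i.succ) : ℤ) * multAt F (p i.succ) =
        n * ν ^ 2 + 2 * ν * ε + 1 := by
      have : ∀ i : Fin n, (multAt F (p i.succ) : ℤ) * multAt F (p i.succ) =
          ν ^ 2 + if i = i₀ then 2 * ν * ε + ε ^ 2 else 0 := by
        intro i
        rw [hmult]
        split_ifs <;> ring
      simp only [this, Finset.sum_add_distrib]
      simp [hε]
      ring
    rw [hs1]
    rw [hs2] at hself
    -- Self-intersection `-1` gives `δ² - μ_0² = n ν² + 2 ν ε`, so the intersection number is `n (n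
    -- ν² + 2 ν ε) - (n ν + ε)² = -ε² = -1`.
    linear_combination n * hself - hε

end TotalCurve

/-! ### The splitting-off lemma -/

section Splitting

variable {n d : ℕ} {p : Fin (n + 1) → Plane} {F : Form}

/-- The sum equals `2 (C·C_σ - C²)`, where `C² = -1` and `C·C_σ ≤ 0`. The last inequality holds
because the quasi-homogeneous class meets `C` and `C_σ` in the same negative number. -/
theorem sum_sub_permute_sq_le (h : IsGeneral d p) (hF : IsNegativeCurve p F)
    (hd : F.totalDegree ≤ d) {m₀ m : ℕ} {H : Form} (hH : H ∈ linearSystem p (quasiHom n d m₀ m))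
    (hneg : (quasiHom n d m₀ m).inter (strictClass p F) < 0) (σ : Equiv.Perm (Fin n)) :
    ∑ i : Fin n, ((multAt F (p i.succ) : ℤ) - multAt F (p (σ i).succ)) ^ 2 ≤ 2 := by
  obtain ⟨E, hE, hdeg, hmult⟩ := hF.exists_permuted h hd (extendPerm σ)
  have hnegE : (quasiHom n d m₀ m).inter (strictClass p E) < 0 := by
    convert hneg using 1
    simp only [DivisorClass.inter, strictClass, quasiHom, Fin.sum_univ_succ, Fin.cons_zero,
      Fin.cons_succ, hdeg, hmult, extendPerm_zero, extendPerm_succ]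
    rw [Equiv.sum_comp σ fun i => (m : ℤ) * multAt F (p i.succ)]
  have hinter := hF.inter_nonpos h.inChart hE hH.1 hH.2.1
    ((inter_strictClass_le hH F).trans_lt hneg) ((inter_strictClass_le hH E).trans_lt hnegE)
  have hself := hF.selfInter
  simp only [DivisorClass.inter, strictClass, Fin.sum_univ_succ, hdeg, hmult, extendPerm_zero,
    extendPerm_succ] at hinter hself
  have hexpand : ∑ i : Fin n, ((multAt F (p i.succ) : ℤ) - multAt F (p (σ i).succ)) ^ 2 =
      2 * ∑ i : Fin n, (multAt F (p i.succ) : ℤ) * multAt F (p i.succ) -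
        2 * ∑ i : Fin n, (multAt F (p i.succ) : ℤ) * multAt F (p (σ i).succ) := by
    have := Equiv.sum_comp σ fun i => (multAt F (p i.succ) : ℤ) * multAt F (p i.succ)
    rw [two_mul]
    nth_rw 1 [← this]
    rw [Finset.mul_sum, ← Finset.sum_add_distrib, ← Finset.sum_sub_distrib]
    exact Finset.sum_congr rfl fun i _ => by ring
  linarith

end Splitting

end PlaneCurves

end

theorem mainTheorem5 (n d : ℕ) :
    ForGeneralPoints fun p : Fin (n + 1) → Plane =>
      ∀ m₀ m : ℕ, (linearSystem p (quasiHom n d m₀ m)).Nonempty →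
      ∀ F : Form, IsMinusOneCurve p F →
        (quasiHom n d m₀ m).inter (strictClass p F) ≤ -2 →
        (∃ μ₁ : ℕ, ∀ i : Fin n, multAt F (p i.succ) = μ₁) ∨
        (∃ (μ₂ : ℕ) (i₀ : Fin n),
          (multAt F (p i₀.succ) : ℤ) = μ₂ - 1 ∧
          (∀ i, i ≠ i₀ → multAt F (p i.succ) = μ₂) ∧
          TotalCurveIs p F
            (quasiHom n (n * F.totalDegree) (n * multAt F (p 0)) (n * μ₂ - 1))) ∨
        (∃ (μ₂ : ℕ) (i₀ : Fin n),
          (multAt F (p i₀.succ) : ℤ) = μ₂ + 1 ∧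
          (∀ i, i ≠ i₀ → multAt F (p i.succ) = μ₂) ∧
          TotalCurveIs p F
            (quasiHom n (n * F.totalDegree) (n * multAt F (p 0)) (n * μ₂ + 1))) := by
  refine (forGeneralPoints_inChart.and (forGeneralPoints_hasMember (n + 1) d)).mono ?_
  rintro p ⟨hchart, hmember⟩ m₀ m ⟨H, hH⟩ F hF hle
  have h : IsGeneral d p := ⟨hchart, hmember⟩
  have hN : IsNegativeCurve p F := ⟨hF.irreducible, hF.homogeneous, hF.selfInter⟩
  have hneg : (quasiHom n d m₀ m).inter (strictClass p F) < 0 := by omega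
  have hdvd := hN.dvd_of_inter_neg hchart hH.2.1 ((inter_strictClass_le hH F).trans_lt hneg)
  -- Generality was imposed only for degrees up to `d`; this suffices for `F`, as it divides `H`.
  have hd : F.totalDegree ≤ d := by
    have hHd : H.totalDegree = d := Nat.cast_injective hH.2.2.1
    rw [← hHd]
    exact totalDegree_le_of_dvd_of_isDomain hdvd hH.1
  rcases eq_const_or_eq_const_except_one (fun i : Fin n => multAt F (p i.succ))
    (sum_sub_permute_sq_le h hN hd hH hneg) with hc | ⟨ν, i₀, hi₀, hi⟩ | ⟨ν, i₀, hi₀, hi⟩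
  · exact Or.inl hc
  · refine Or.inr (Or.inl ⟨ν, i₀, hi₀, hi, ?_⟩)
    exact totalCurveIs_quasiHom h hN hd (ε := -1) (by norm_num) hi₀ hi
  · refine Or.inr (Or.inr ⟨ν, i₀, hi₀, hi, ?_⟩)
    exact totalCurveIs_quasiHom h hN hd (by norm_num) hi₀ hi
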